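/- Let $\mathcal H$ be a complex separable Hilbert space (finite- or infinite-dimensional) with $\dim\mathcal H\ge 2$, let $\mathcal T(\mathcal H)$ be the space of trace class operators on $\mathcal H$ with the trace norm, $\mathcal B(\mathcal H\otimes\mathcal H)$ the space of bounded operators on the Hilbert space tensor product with the operator norm, and $S\in\mathcal B(\mathcal H\otimes\mathcal H)$ the swap operator, $S(x\otimes y)=y\otimes x$. Let $\Phi:\mathcal T(\mathcal H)\to\mathcal B(\mathcal H\otimes\mathcal H)$ be a continuous linear map that is covariant under unitary evolution, i.e. $\Phi(UXU^*)=(U\otimes U)\Phi(X)(U^*\otimes U^*)$ for all $X\in\mathcal T(\mathcal H)$ and all unitary operators $U$ on $\mathcal H$. (a) $\Phi$ is self-adjoint (Hermitian-preserving), i.e. $\Phi(X^*)=\Phi(X)^*$ for all $X\in\mathcal T(\mathcal H)$, if and only if there exist real numbers $\mu_1,\mu_2,\mu_5,\mu_6$ and complex numbers $\mu_3=\overline{\mu_4}$ such that for all $X\in\mathcal T(\mathcal H)$ $$\Phi(X)=\mu_1\, I\otimes X+\mu_2\, X\otimes I+\mu_3\, S(I\otimes X)+\mu_4\, S(X\otimes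 I)+\mu_5\,\mathrm{tr}(X)\, I\otimes I+\mu_6\,\mathrm{tr}(X)\, S.\qquad(*)$$ (b) $\Phi$ is positive, i.e. $\Phi(X)\ge 0$ for all $X\in\mathcal T(\mathcal H)$ with $X\ge 0$, if and only if $\Phi$ has the form $(*)$ with real $\mu_1,\mu_2,\mu_5,\mu_6$ and complex $\mu_3=\overline{\mu_4}$ that satisfy $\sum_{i=1}^6\mu_i\ge 0$, the matrix $$\begin{pmatrix}\mu_1+\mu_5&\overline{\mu_3}+\mu_6\\ \mu_3+\mu_6&\mu_2+\mu_5\end{pmatrix}$$ is positive semidefinite, and $$\mu_5\ge|\mu_6|\ \text{ if }\dim\mathcal H\ge 3,\qquad \mu_5+\mu_6\ge 0\ \text{ if }\dim\mathcal H=2.$$ Moreover, whenever $\Phi$ is written in the form $(*)$ with real $\mu_1,\mu_2,\mu_5,\mu_6$ and complex $\mu_3=\overline{\mu_4}$, $\Phi$ is positive if and only if these coefficients satisfy the above conditions. -/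

import Mathlib

open scoped InnerProductSpace TensorProduct ENNReal ComplexOrder

set_option linter.unusedSectionVars false

noncomputable section

namespace UnitaryCovariance

variable {H : Type*} [NormedAddCommGroup H] [InnerProductSpace ℂ H] [CompleteSpace H]

/-! ## The trace norm -/

/-- Index set of a fixed orthonormal (Hilbert) basis of `H`. -/
def BasisIndex (H : Type*) [NormedAddCommGroup H] [InnerProductSpace ℂ H] [CompleteSpace H] :
    Set H :=
  (exists_hilbertBasis ℂ H).choose

/-- A fixed orthonormal (Hilbert) basis of `H`. The trace and the trace norm do not depend on this
choice, see `traceNorm_eq_tsum` and `TraceClass.hasSum_trace`. -/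
def stdBasis (H : Type*) [NormedAddCommGroup H] [InnerProductSpace ℂ H] [CompleteSpace H] :
    HilbertBasis (BasisIndex H) ℂ H :=
  (exists_hilbertBasis ℂ H).choose_spec.choose

/-- The trace norm `tr |T| = ∑ᵢ ⟨|T| eᵢ, eᵢ⟩` with `|T| = (T* T)^(1/2)`, as an extended nonnegative
number. -/
def traceNorm (T : H →L[ℂ] H) : ℝ≥0∞ :=
  ∑' i, ENNReal.ofReal (RCLike.re ⟪stdBasis H i, CFC.abs T (stdBasis H i)⟫_ℂ)

theorem parseval {ι : Type*} (b : HilbertBasis ι ℂ H) (x : H) :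
    ∑' i, ‖⟪b i, x⟫_ℂ‖ₑ ^ 2 = ‖x‖ₑ ^ 2 := by
  have h := b.hasSum_inner_mul_inner x x
  have h2 : HasSum (fun i => ‖⟪b i, x⟫_ℂ‖ ^ 2) (‖x‖ ^ 2) := by
    have := Complex.hasSum_re h
    convert this using 1
    · funext i
      rw [← inner_conj_symm x (b i), RCLike.conj_mul]
      norm_cast
    · rw [inner_self_eq_norm_sq_to_K]
      norm_cast
  have h3 : ∀ y : ℝ, 0 ≤ y → ENNReal.ofReal (y ^ 2) = ENNReal.ofReal y ^ 2 :=
    fun y hy => ENNReal.ofReal_pow hy 2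
  have h4 := ENNReal.ofReal_tsum_of_nonneg (fun i => sq_nonneg ‖⟪b i, x⟫_ℂ‖) h2.summable
  rw [h2.tsum_eq] at h4
  simp only [h3 _ (norm_nonneg _), ofReal_norm] at h4
  exact h4.symm

theorem tsum_sq_adjoint {ι κ : Type*} (b : HilbertBasis ι ℂ H) (c : HilbertBasis κ ℂ H)
    (A : H →L[ℂ] H) : ∑' i, ‖A (b i)‖ₑ ^ 2 = ∑' j, ‖(star A) (c j)‖ₑ ^ 2 := by
  simp_rw [← parseval c (A _), ← parseval b ((star A) _)]
  rw [ENNReal.tsum_comm]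
  refine tsum_congr fun j => tsum_congr fun i => ?_
  rw [ContinuousLinearMap.star_eq_adjoint, ContinuousLinearMap.adjoint_inner_right,
    ← inner_conj_symm, ← ofReal_norm, RCLike.norm_conj, ofReal_norm]

theorem tsum_sq_basis {ι κ : Type*} (b : HilbertBasis ι ℂ H) (c : HilbertBasis κ ℂ H)
    (A : H →L[ℂ] H) : ∑' i, ‖A (b i)‖ₑ ^ 2 = ∑' j, ‖A (c j)‖ₑ ^ 2 := by
  rw [tsum_sq_adjoint b b, tsum_sq_adjoint b c, star_star]

theorem ofReal_re_inner_nonneg (P : H →L[ℂ] H) (hP : 0 ≤ P) (x : H) :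
    ENNReal.ofReal (RCLike.re ⟪x, P x⟫_ℂ) = ‖CFC.sqrt P x‖ₑ ^ 2 := by
  have h1 : P = star (CFC.sqrt P) * CFC.sqrt P := by
    rw [(IsSelfAdjoint.of_nonneg (CFC.sqrt_nonneg P)).star_eq, CFC.sqrt_mul_sqrt_self P hP]
  conv_lhs => rw [h1]
  rw [mul_apply_eq_comp, ContinuousLinearMap.star_eq_adjoint,
    ContinuousLinearMap.adjoint_inner_right, inner_self_eq_norm_sq,
    ENNReal.ofReal_pow (norm_nonneg _), ofReal_norm]

theorem traceNorm_eq_sqrt {ι : Type*} (b : HilbertBasis ι ℂ H) (T : H →L[ℂ] H) :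
    traceNorm T = ∑' i, ‖CFC.sqrt (CFC.abs T) (b i)‖ₑ ^ 2 := by
  rw [tsum_sq_basis b (stdBasis H)]
  exact tsum_congr fun i => ofReal_re_inner_nonneg _ (CFC.abs_nonneg T) _

/-- The trace norm does not depend on the orthonormal basis. -/
theorem traceNorm_eq_tsum {ι : Type*} (b : HilbertBasis ι ℂ H) (T : H →L[ℂ] H) :
    traceNorm T = ∑' i, ENNReal.ofReal (RCLike.re ⟪b i, CFC.abs T (b i)⟫_ℂ) := by
  rw [traceNorm_eq_sqrt b]
  exact tsum_congr fun i => (ofReal_re_inner_nonneg _ (CFC.abs_nonneg T) _).symm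

theorem norm_abs_apply (T : H →L[ℂ] H) (x : H) : ‖CFC.abs T x‖ = ‖T x‖ := by
  have h : ⟪CFC.abs T x, CFC.abs T x⟫_ℂ = ⟪T x, T x⟫_ℂ := by
    rw [← ContinuousLinearMap.adjoint_inner_right, ← ContinuousLinearMap.adjoint_inner_right,
      ← ContinuousLinearMap.star_eq_adjoint, ← ContinuousLinearMap.star_eq_adjoint,
      (IsSelfAdjoint.of_nonneg (CFC.abs_nonneg T)).star_eq, ← mul_apply_eq_comp,
      ← mul_apply_eq_comp, CFC.abs_mul_abs]
  rw [inner_self_eq_norm_sq_to_K, inner_self_eq_norm_sq_to_K] at h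
  have h2 : ‖CFC.abs T x‖ ^ 2 = ‖T x‖ ^ 2 := by exact_mod_cast h
  exact (sq_eq_sq₀ (norm_nonneg _) (norm_nonneg _)).1 h2

/-- Polar decomposition with a contraction. -/
theorem exists_polar (T : H →L[ℂ] H) : ∃ V : H →L[ℂ] H, (∀ x, ‖V x‖ ≤ ‖x‖) ∧
    (∀ x, ‖star V x‖ ≤ ‖x‖) ∧ T = V * CFC.abs T ∧ CFC.abs T = star V * T := by
  set P := CFC.abs T with hP
  let K : Submodule ℂ H := P.range.topologicalClosure
  have hmem : ∀ x, P x ∈ K := fun x =>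
    P.range.le_topologicalClosure (LinearMap.mem_range_self _ x)
  let e : H →ₗ[ℂ] K := (P : H →ₗ[ℂ] H).codRestrict K hmem
  have hdense : DenseRange e := by
    intro y
    rw [closure_subtype]
    have hy := y.2
    rw [← SetLike.mem_coe, Submodule.topologicalClosure_coe] at hy
    refine closure_mono ?_ hy
    rintro _ ⟨x, rfl⟩
    exact ⟨e x, ⟨x, rfl⟩, rfl⟩
  have hb : ∀ x, ‖(T : H →ₗ[ℂ] H) x‖ ≤ 1 * ‖e x‖ := fun x => by
    rw [one_mul]; exact (norm_abs_apply T x).ge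
  let g : K →L[ℂ] H := (T : H →ₗ[ℂ] H).extendOfNorm e
  have hg1 : ∀ x, g (e x) = T x := LinearMap.extendOfNorm_eq hdense ⟨1, hb⟩
  have hg2 : ∀ y, ‖g y‖ ≤ 1 * ‖y‖ := LinearMap.norm_extendOfNorm_apply_le hdense 1 hb
  have : CompleteSpace K := P.range.isClosed_topologicalClosure.completeSpace_coe
  let V : H →L[ℂ] H := g ∘L K.orthogonalProjectionOnto
  have hV : ∀ x, ‖V x‖ ≤ ‖x‖ := fun x => by
    refine (hg2 _).trans ?_
    rw [one_mul]
    exact K.norm_orthogonalProjectionOnto_apply_le x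
  have hVP : ∀ x, V (P x) = T x := fun x => by
    have : K.orthogonalProjectionOnto (P x) = e x :=
      Submodule.orthogonalProjectionOnto_mem_subspace_eq_self (K := K) (e x)
    show g (K.orthogonalProjectionOnto (P x)) = T x
    rw [this, hg1]
  have hVn : ‖star V‖ ≤ 1 := by
    rw [norm_star]
    exact V.opNorm_le_bound zero_le_one fun x => by simpa using hV x
  have hV' : ∀ x, ‖star V x‖ ≤ ‖x‖ := fun x => by
    simpa using (star V).le_of_opNorm_le hVn x
  refine ⟨V, hV, hV', ?_, ?_⟩
  · ext x
    exact (hVP x).symm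
  · ext x
    have h1 : ‖V (P x)‖ = ‖P x‖ := by rw [hVP, norm_abs_apply]
    have h2 : star V (V (P x)) = P x := by
      rw [← sub_eq_zero, ← norm_le_zero_iff]
      have h3 := norm_sub_sq (𝕜 := ℂ) (star V (V (P x))) (P x)
      rw [ContinuousLinearMap.star_eq_adjoint, ContinuousLinearMap.adjoint_inner_left,
        inner_self_eq_norm_sq, ← ContinuousLinearMap.star_eq_adjoint, h1] at h3
      have h4 : ‖star V (V (P x))‖ ≤ ‖P x‖ := (hV' _).trans h1.le
      have h5 := norm_nonneg (star V (V (P x)))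
      nlinarith [norm_nonneg (star V (V (P x)) - P x)]
    rw [mul_apply_eq_comp, ← hVP x, h2]

theorem traceNorm_le_tsum_inner (T : H →L[ℂ] H) : ∃ V : H →L[ℂ] H, (∀ x, ‖V x‖ ≤ ‖x‖) ∧
    traceNorm T ≤ ∑' i, ‖⟪V (stdBasis H i), T (stdBasis H i)⟫_ℂ‖ₑ := by
  obtain ⟨V, hV, -, -, h⟩ := exists_polar T
  refine ⟨V, hV, ENNReal.tsum_le_tsum fun i => ?_⟩
  rw [h, mul_apply_eq_comp, ContinuousLinearMap.star_eq_adjoint,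
    ContinuousLinearMap.adjoint_inner_right, ← ofReal_norm]
  exact ENNReal.ofReal_le_ofReal (RCLike.re_le_norm _)

theorem tsum_sq_mul_le {ι : Type*} (b : HilbertBasis ι ℂ H) (A C : H →L[ℂ] H)
    (hC : ∀ x, ‖star C x‖ ≤ ‖x‖) :
    ∑' i, ‖A (C (b i))‖ₑ ^ 2 ≤ ∑' i, ‖(star A) (b i)‖ₑ ^ 2 := by
  rw [show (∑' i, ‖A (C (b i))‖ₑ ^ 2) = ∑' i, ‖(A * C) (b i)‖ₑ ^ 2 from rfl,
    tsum_sq_adjoint b b (A * C)]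
  refine ENNReal.tsum_le_tsum fun i => ?_
  rw [star_mul, mul_apply_eq_comp]
  gcongr
  exact enorm_le_iff_norm_le.2 (hC _)

theorem enorm_mul_le_half_sq (a b : ℝ≥0∞) : a * b ≤ 2⁻¹ * (a ^ 2 + b ^ 2) := by
  by_cases ha : a = ⊤
  · subst ha
    simp
  by_cases hb : b = ⊤
  · subst hb
    simp
  lift a to NNReal using ha
  lift b to NNReal using hb
  have h2 : (2⁻¹ : ℝ≥0∞) = ((2⁻¹ : NNReal) : ℝ≥0∞) := by simp
  rw [h2]
  norm_cast
  rw [← NNReal.coe_le_coe]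
  push_cast
  nlinarith [sq_nonneg ((a : ℝ) - b)]

theorem star_apply_le {U : H →L[ℂ] H} (hU : ∀ x, ‖U x‖ ≤ ‖x‖) (x : H) : ‖star U x‖ ≤ ‖x‖ := by
  have h : ‖star U‖ ≤ 1 := by
    rw [norm_star]
    exact U.opNorm_le_bound zero_le_one fun x => by simpa using hU x
  simpa using (star U).le_of_opNorm_le h x

theorem tsum_inner_le {ι : Type*} (b : HilbertBasis ι ℂ H) (T U W : H →L[ℂ] H)
    (hU : ∀ x, ‖U x‖ ≤ ‖x‖) (hW : ∀ x, ‖W x‖ ≤ ‖x‖) :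
    ∑' i, ‖⟪U (b i), T (W (b i))⟫_ℂ‖ₑ ≤ traceNorm T := by
  obtain ⟨V, hV, hV', h, -⟩ := exists_polar T
  set R := CFC.sqrt (CFC.abs T) with hR
  have hRs : star R = R := (IsSelfAdjoint.of_nonneg (CFC.sqrt_nonneg _)).star_eq
  have hRR : R * R = CFC.abs T := CFC.sqrt_mul_sqrt_self _ (CFC.abs_nonneg T)
  have key : ∀ i, ‖⟪U (b i), T (W (b i))⟫_ℂ‖ₑ ≤
      2⁻¹ * (‖R ((star V * U) (b i))‖ₑ ^ 2 + ‖R (W (b i))‖ₑ ^ 2) := fun i => by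
    refine le_trans ?_ (enorm_mul_le_half_sq _ _)
    have : ⟪U (b i), T (W (b i))⟫_ℂ = ⟪R ((star V * U) (b i)), R (W (b i))⟫_ℂ := by
      conv_lhs => rw [h, ← hRR]
      rw [mul_apply_eq_comp, mul_apply_eq_comp,
        mul_apply_eq_comp, ← ContinuousLinearMap.adjoint_inner_left,
        ← ContinuousLinearMap.adjoint_inner_left, ← ContinuousLinearMap.star_eq_adjoint,
        ← ContinuousLinearMap.star_eq_adjoint, hRs]
    rw [this, ← ofReal_norm, ← ofReal_norm, ← ofReal_norm, ← ENNReal.ofReal_mul (norm_nonneg _)]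
    exact ENNReal.ofReal_le_ofReal (norm_inner_le_norm _ _)
  refine (ENNReal.tsum_le_tsum key).trans ?_
  rw [ENNReal.tsum_mul_left, ENNReal.tsum_add]
  have h1 := tsum_sq_mul_le b R (star V * U) (fun x => by
    rw [star_mul, star_star]
    exact (star_apply_le hU _).trans (hV x))
  have h2 := tsum_sq_mul_le b R W (star_apply_le hW)
  rw [hRs, ← traceNorm_eq_sqrt b] at h1 h2
  calc 2⁻¹ * (_ + _) ≤ 2⁻¹ * (traceNorm T + traceNorm T) := by gcongr
    _ = traceNorm T := by
      rw [← two_mul, ← mul_assoc, ENNReal.inv_mul_cancel two_ne_zero ENNReal.ofNat_ne_top, one_mul]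

theorem traceNorm_mul_mul_le (A T B : H →L[ℂ] H) (hA : ∀ x, ‖A x‖ ≤ ‖x‖)
    (hB : ∀ x, ‖B x‖ ≤ ‖x‖) : traceNorm (A * T * B) ≤ traceNorm T := by
  obtain ⟨V, hV, h⟩ := traceNorm_le_tsum_inner (A * T * B)
  refine h.trans ((le_of_eq (tsum_congr fun i => ?_)).trans
    (tsum_inner_le (stdBasis H) T (star A * V) B
      (fun x => (star_apply_le hA _).trans (hV x)) hB))
  rw [mul_apply_eq_comp, mul_apply_eq_comp, mul_apply_eq_comp,
    ContinuousLinearMap.star_eq_adjoint, ContinuousLinearMap.adjoint_inner_left]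

theorem traceNorm_add_le (S T : H →L[ℂ] H) : traceNorm (S + T) ≤ traceNorm S + traceNorm T := by
  obtain ⟨V, hV, h⟩ := traceNorm_le_tsum_inner (S + T)
  have hid : ∀ x : H, ‖(1 : H →L[ℂ] H) x‖ ≤ ‖x‖ := fun x => le_rfl
  refine h.trans (le_trans ?_ (add_le_add (tsum_inner_le (stdBasis H) S V 1 hV hid)
    (tsum_inner_le (stdBasis H) T V 1 hV hid)))
  rw [← ENNReal.tsum_add]
  refine ENNReal.tsum_le_tsum fun i => ?_
  rw [add_apply, inner_add_right]
  exact enorm_add_le _ _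

theorem traceNorm_smul_le (c : ℂ) (T : H →L[ℂ] H) : traceNorm (c • T) ≤ ‖c‖ₑ * traceNorm T := by
  obtain ⟨V, hV, h⟩ := traceNorm_le_tsum_inner (c • T)
  refine h.trans (le_trans ?_ (mul_le_mul_right (tsum_inner_le (stdBasis H) T V 1 hV
    fun x => le_rfl) _))
  rw [← ENNReal.tsum_mul_left]
  refine ENNReal.tsum_le_tsum fun i => ?_
  rw [smul_apply, inner_smul_right, enorm_mul]
  rfl

theorem traceNorm_star_le (T : H →L[ℂ] H) : traceNorm (star T) ≤ traceNorm T := by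
  obtain ⟨V, hV, h⟩ := traceNorm_le_tsum_inner (star T)
  refine h.trans (le_trans (le_of_eq (tsum_congr fun i => ?_))
    (tsum_inner_le (stdBasis H) T 1 V (fun x => le_rfl) hV))
  rw [ContinuousLinearMap.star_eq_adjoint, ContinuousLinearMap.adjoint_inner_right,
    ← inner_conj_symm, ← ofReal_norm, RCLike.norm_conj, ofReal_norm]
  rfl

theorem traceNorm_zero : traceNorm (0 : H →L[ℂ] H) = 0 := by
  simp [traceNorm]

theorem eq_zero_of_traceNorm_eq_zero (T : H →L[ℂ] H) (h : traceNorm T = 0) : T = 0 := by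
  rw [traceNorm_eq_sqrt (stdBasis H), ENNReal.tsum_eq_zero] at h
  set R := CFC.sqrt (CFC.abs T) with hR
  have h2 : ∀ i, R (stdBasis H i) = 0 := fun i => by simpa using h i
  have hRR : R * R = CFC.abs T := CFC.sqrt_mul_sqrt_self _ (CFC.abs_nonneg T)
  have hR0 : R = 0 := by
    ext x
    have hx : x ∈ (Submodule.span ℂ (Set.range (stdBasis H))).topologicalClosure := by
      rw [(stdBasis H).dense_span]; trivial
    have hle : (Submodule.span ℂ (Set.range (stdBasis H))).topologicalClosure ≤
        LinearMap.ker (R : H →ₗ[ℂ] H) :=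
      Submodule.topologicalClosure_minimal _ (Submodule.span_le.2 (by
        rintro _ ⟨i, rfl⟩
        exact h2 i)) R.isClosed_ker
    exact hle hx
  ext x
  rw [zero_apply, ← norm_eq_zero, ← norm_abs_apply, ← hRR, hR0]
  simp

/-! ## The Banach space of trace class operators -/

/-- The subspace of trace class operators. -/
def traceClassSubmodule (H : Type*) [NormedAddCommGroup H] [InnerProductSpace ℂ H]
    [CompleteSpace H] : Submodule ℂ (H →L[ℂ] H) where
  carrier := {T | traceNorm T < ⊤}
  add_mem' := fun hS hT => (traceNorm_add_le _ _).trans_lt (ENNReal.add_lt_top.2 ⟨hS, hT⟩)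
  zero_mem' := by
    show traceNorm 0 < ⊤
    rw [traceNorm_zero]
    exact ENNReal.zero_lt_top
  smul_mem' := fun c _ hT => (traceNorm_smul_le c _).trans_lt (ENNReal.mul_lt_top enorm_lt_top hT)

/-- The space `𝒯(H)` of trace class operators. This is a type of its own because it carries the
trace norm, not the operator norm. -/
def TraceClass (H : Type*) [NormedAddCommGroup H] [InnerProductSpace ℂ H] [CompleteSpace H] :
    Type _ :=
  traceClassSubmodule H

namespace TraceClass

instance : AddCommGroup (TraceClass H) := inferInstanceAs (AddCommGroup (traceClassSubmodule H))

instance : Module ℂ (TraceClass H) := inferInstanceAs (Module ℂ (traceClassSubmodule H))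

/-- A trace class operator as a bounded operator. -/
def toOp (X : TraceClass H) : H →L[ℂ] H := Subtype.val X

/-- A bounded operator of finite trace norm as an element of `𝒯(H)`. -/
def ofOp (T : H →L[ℂ] H) (hT : traceNorm T < ⊤) : TraceClass H := ⟨T, hT⟩

theorem traceNorm_lt_top (X : TraceClass H) : traceNorm X.toOp < ⊤ := Subtype.property X

@[ext]
theorem ext {X Y : TraceClass H} (h : X.toOp = Y.toOp) : X = Y := Subtype.ext h

@[simp]
theorem toOp_ofOp (T : H →L[ℂ] H) (hT : traceNorm T < ⊤) : (ofOp T hT).toOp = T := rfl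

@[simp]
theorem toOp_zero : (0 : TraceClass H).toOp = 0 := rfl

@[simp]
theorem toOp_add (X Y : TraceClass H) : (X + Y).toOp = X.toOp + Y.toOp := rfl

@[simp]
theorem toOp_smul (c : ℂ) (X : TraceClass H) : (c • X).toOp = c • X.toOp := rfl

instance : Norm (TraceClass H) := ⟨fun X => (traceNorm X.toOp).toReal⟩

theorem norm_def (X : TraceClass H) : ‖X‖ = (traceNorm X.toOp).toReal := rfl

theorem core : NormedSpace.Core ℂ (TraceClass H) where
  norm_nonneg X := ENNReal.toReal_nonneg
  norm_smul c X := by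
    have hle : ∀ (c : ℂ) (X : TraceClass H), ‖c • X‖ ≤ ‖c‖ * ‖X‖ := fun c X => by
      rw [norm_def, norm_def, ← toReal_enorm c, ← ENNReal.toReal_mul]
      exact ENNReal.toReal_mono (ENNReal.mul_lt_top enorm_lt_top X.traceNorm_lt_top).ne
        (traceNorm_smul_le c _)
    refine le_antisymm (hle c X) ?_
    by_cases hc : c = 0
    · rw [hc, norm_zero, zero_mul]
      exact ENNReal.toReal_nonneg
    · have h := hle c⁻¹ (c • X)
      rw [smul_smul, inv_mul_cancel₀ hc, one_smul, norm_inv] at h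
      rwa [inv_mul_eq_div, le_div_iff₀ (norm_pos_iff.2 hc), mul_comm] at h
  norm_triangle X Y := by
    rw [norm_def, norm_def, norm_def,
      ← ENNReal.toReal_add X.traceNorm_lt_top.ne Y.traceNorm_lt_top.ne]
    exact ENNReal.toReal_mono
      (ENNReal.add_lt_top.2 ⟨X.traceNorm_lt_top, Y.traceNorm_lt_top⟩).ne (traceNorm_add_le _ _)
  norm_eq_zero_iff X := by
    constructor
    · intro h
      refine TraceClass.ext (eq_zero_of_traceNorm_eq_zero _ ?_)
      exact ((ENNReal.toReal_eq_zero_iff _).1 h).resolve_right X.traceNorm_lt_top.ne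
    · rintro rfl
      rw [norm_def, toOp_zero, traceNorm_zero, ENNReal.toReal_zero]

instance : NormedAddCommGroup (TraceClass H) := NormedAddCommGroup.ofCore core

instance : NormedSpace ℂ (TraceClass H) := NormedSpace.ofCore core

/-- The adjoint `X*` of a trace class operator. -/
instance : Star (TraceClass H) :=
  ⟨fun X => ofOp (star X.toOp) ((traceNorm_star_le _).trans_lt X.traceNorm_lt_top)⟩

@[simp]
theorem toOp_star (X : TraceClass H) : (star X).toOp = star X.toOp := rfl

/-- The operator `U X U*`. -/
def conj (U : unitary (H →L[ℂ] H)) (X : TraceClass H) : TraceClass H :=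
  ofOp ((U : H →L[ℂ] H) * X.toOp * star (U : H →L[ℂ] H)) <|
    (traceNorm_mul_mul_le _ _ _ (fun x => (ContinuousLinearMap.norm_map_of_mem_unitary U.2 x).le)
      (fun x => (ContinuousLinearMap.norm_map_of_mem_unitary (Unitary.star_mem U.2) x).le)).trans_lt
      X.traceNorm_lt_top

@[simp]
theorem toOp_conj (U : unitary (H →L[ℂ] H)) (X : TraceClass H) :
    (conj U X).toOp = (U : H →L[ℂ] H) * X.toOp * star (U : H →L[ℂ] H) := rfl

/-- The trace `tr X = ∑ᵢ ⟨X eᵢ, eᵢ⟩` (the inner product of Mathlib is linear in the second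
argument). -/
def trace (X : TraceClass H) : ℂ :=
  ∑' i, ⟪stdBasis H i, X.toOp (stdBasis H i)⟫_ℂ

theorem hasSum_norm_sq {ι : Type*} (b : HilbertBasis ι ℂ H) (C : H →L[ℂ] H)
    (hC : ∑' i, ‖C (stdBasis H i)‖ₑ ^ 2 < ⊤) :
    HasSum (fun i => ‖C (b i)‖ ^ 2) (∑' i, ‖C (stdBasis H i)‖ₑ ^ 2).toReal := by
  rw [tsum_sq_basis (stdBasis H) b] at hC ⊢
  have h := ENNReal.hasSum_toReal hC.ne
  simpa [ENNReal.tsum_toReal_eq (fun i => by simp : ∀ i, ‖C (b i)‖ₑ ^ 2 ≠ ⊤)] using h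

theorem tsum_sq_add_smul_lt_top (A B : H →L[ℂ] H) (c : ℂ)
    (hA : ∑' i, ‖A (stdBasis H i)‖ₑ ^ 2 < ⊤) (hB : ∑' i, ‖B (stdBasis H i)‖ₑ ^ 2 < ⊤) :
    ∑' i, ‖(A + c • B) (stdBasis H i)‖ₑ ^ 2 < ⊤ := by
  have key : ∀ i, ‖(A + c • B) (stdBasis H i)‖ₑ ^ 2 ≤
      2 * (‖A (stdBasis H i)‖ₑ ^ 2 + ‖c‖ₑ ^ 2 * ‖B (stdBasis H i)‖ₑ ^ 2) := fun i => by
    rw [← mul_pow, ← enorm_smul]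
    refine (pow_le_pow_left' (enorm_add_le _ _) 2).trans ?_
    set x := ‖A (stdBasis H i)‖ₑ
    set y := ‖(c • B) (stdBasis H i)‖ₑ
    have h2 : 2 * (x * y) ≤ x ^ 2 + y ^ 2 := by
      refine (mul_le_mul_right (enorm_mul_le_half_sq x y) 2).trans (le_of_eq ?_)
      rw [← mul_assoc, ENNReal.mul_inv_cancel two_ne_zero ENNReal.ofNat_ne_top, one_mul]
    calc (x + y) ^ 2 = (x ^ 2 + y ^ 2) + 2 * (x * y) := by ring
      _ ≤ (x ^ 2 + y ^ 2) + (x ^ 2 + y ^ 2) := by gcongr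
      _ = 2 * (x ^ 2 + y ^ 2) := by ring
  refine (ENNReal.tsum_le_tsum key).trans_lt ?_
  rw [ENNReal.tsum_mul_left, ENNReal.tsum_add, ENNReal.tsum_mul_left]
  exact ENNReal.mul_lt_top (by simp) (ENNReal.add_lt_top.2
    ⟨hA, ENNReal.mul_lt_top (by simp) hB⟩)

/-- The series defining the trace converges to the trace in every orthonormal basis. -/
theorem hasSum_trace {ι : Type*} (b : HilbertBasis ι ℂ H) (X : TraceClass H) :
    HasSum (fun i => ⟪b i, X.toOp (b i)⟫_ℂ) X.trace := by
  obtain ⟨V, hV, hV', h, -⟩ := exists_polar X.toOp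
  set R := CFC.sqrt (CFC.abs X.toOp) with hR
  have hRs : star R = R := (IsSelfAdjoint.of_nonneg (CFC.sqrt_nonneg _)).star_eq
  have hRR : R * R = CFC.abs X.toOp := CFC.sqrt_mul_sqrt_self _ (CFC.abs_nonneg _)
  have hB : ∑' i, ‖R (stdBasis H i)‖ₑ ^ 2 < ⊤ := by
    rw [← traceNorm_eq_sqrt]
    exact X.traceNorm_lt_top
  set A := R * star V with hAdef
  have hA : ∑' i, ‖A (stdBasis H i)‖ₑ ^ 2 < ⊤ := by
    have := tsum_sq_mul_le (stdBasis H) R (star V) (fun x => by rw [star_star]; exact hV x)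
    rw [hRs] at this
    exact this.trans_lt hB
  have hin : ∀ x, ⟪x, X.toOp x⟫_ℂ =
      ((‖(A + (1 : ℂ) • R) x‖ ^ 2 : ℝ) - (‖(A + (-1 : ℂ) • R) x‖ ^ 2 : ℝ) +
      ((‖(A + (-Complex.I) • R) x‖ ^ 2 : ℝ) - (‖(A + Complex.I • R) x‖ ^ 2 : ℝ)) * Complex.I) / 4 :=
    fun x => by
      have h1 : ⟪x, X.toOp x⟫_ℂ = ⟪A x, R x⟫_ℂ := by
        conv_lhs => rw [h, ← hRR]
        rw [mul_apply_eq_comp, mul_apply_eq_comp, ← ContinuousLinearMap.adjoint_inner_left,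
          ← ContinuousLinearMap.adjoint_inner_left, ← ContinuousLinearMap.star_eq_adjoint,
          ← ContinuousLinearMap.star_eq_adjoint, hRs]
        rfl
      rw [h1, inner_eq_sum_norm_sq_div_four]
      simp [sub_eq_add_neg]
  have key : ∀ z : ℂ, HasSum
      (fun i => ((‖(A + z • R) (b i)‖ ^ 2 : ℝ) : ℂ))
      (((∑' i, ‖(A + z • R) (stdBasis H i)‖ₑ ^ 2).toReal : ℝ) : ℂ) := fun z =>
    (hasSum_norm_sq b (A + z • R) (tsum_sq_add_smul_lt_top A R z hA hB)).mapL Complex.ofRealCLM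
  have key' : ∀ z : ℂ, HasSum
      (fun i => ((‖(A + z • R) (stdBasis H i)‖ ^ 2 : ℝ) : ℂ))
      (((∑' i, ‖(A + z • R) (stdBasis H i)‖ₑ ^ 2).toReal : ℝ) : ℂ) := fun z =>
    (hasSum_norm_sq (stdBasis H) (A + z • R) (tsum_sq_add_smul_lt_top A R z hA hB)).mapL Complex.ofRealCLM
  have hb := ((((key 1).sub (key (-1))).add
    (((key (-Complex.I)).sub (key Complex.I)).mul_right Complex.I)).div_const 4)
  have hs := ((((key' 1).sub (key' (-1))).add
    (((key' (-Complex.I)).sub (key' Complex.I)).mul_right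
      Complex.I)).div_const 4)
  simp only [← hin] at hb hs
  rw [trace, hs.tsum_eq]
  exact hb

/-- The series defining the trace converges absolutely in every orthonormal basis. -/
theorem summable_norm_inner {ι : Type*} (b : HilbertBasis ι ℂ H) (X : TraceClass H) :
    Summable fun i => ‖⟪b i, X.toOp (b i)⟫_ℂ‖ := by
  have h := (tsum_inner_le b X.toOp 1 1 (fun x => le_rfl) fun x => le_rfl).trans_lt
    X.traceNorm_lt_top
  have h2 := ENNReal.summable_toReal h.ne
  simpa using h2

end TraceClass

/-! ## The Hilbert space tensor product -/

/-- The Hilbert space tensor product `H ⊗ H`: the completion of the algebraic tensor product. -/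
abbrev HilbertTensor (H : Type*) [NormedAddCommGroup H] [InnerProductSpace ℂ H] : Type _ :=
  UniformSpace.Completion (H ⊗[ℂ] H)

/-- The bounded operator `A ⊗ B` on `H ⊗ H`. -/
def tensorOp (A B : H →L[ℂ] H) : HilbertTensor H →L[ℂ] HilbertTensor H :=
  (TensorProduct.mapL A B).completion

/-- The swap operator on `H ⊗ H`. -/
def swap (H : Type*) [NormedAddCommGroup H] [InnerProductSpace ℂ H] :
    HilbertTensor H →L[ℂ] HilbertTensor H :=
  ((TensorProduct.commIsometry ℂ H H).toContinuousLinearEquiv :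
    H ⊗[ℂ] H →L[ℂ] H ⊗[ℂ] H).completion

theorem tensorOp_tmul (A B : H →L[ℂ] H) (x y : H) :
    tensorOp A B ((x ⊗ₜ[ℂ] y : H ⊗[ℂ] H) : HilbertTensor H) =
      ((A x ⊗ₜ[ℂ] B y : H ⊗[ℂ] H) : HilbertTensor H) := by
  simp [tensorOp]

theorem swap_tmul (x y : H) :
    swap H ((x ⊗ₜ[ℂ] y : H ⊗[ℂ] H) : HilbertTensor H) =
      ((y ⊗ₜ[ℂ] x : H ⊗[ℂ] H) : HilbertTensor H) := by
  simp [swap]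

/-! ## Maps `𝒯(H) → ℬ(H ⊗ H)` -/

/-- Covariance under unitary evolution: `Φ(U X U*) = (U ⊗ U) Φ(X) (U* ⊗ U*)`. -/
def IsCovariant (Φ : TraceClass H →L[ℂ] (HilbertTensor H →L[ℂ] HilbertTensor H)) : Prop :=
  ∀ (U : unitary (H →L[ℂ] H)) (X : TraceClass H),
    Φ (TraceClass.conj U X) =
      tensorOp (U : H →L[ℂ] H) (U : H →L[ℂ] H) * Φ X *
        tensorOp (star (U : H →L[ℂ] H)) (star (U : H →L[ℂ] H))

/-- `Φ` is self-adjoint (Hermitian-preserving): `Φ(X*) = Φ(X)*`. -/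
def IsHermitianPreserving
    (Φ : TraceClass H →L[ℂ] (HilbertTensor H →L[ℂ] HilbertTensor H)) : Prop :=
  ∀ X : TraceClass H, Φ (star X) = star (Φ X)

/-- `Φ` is positive: it maps positive operators to positive operators. -/
def IsPositiveMap (Φ : TraceClass H →L[ℂ] (HilbertTensor H →L[ℂ] HilbertTensor H)) : Prop :=
  ∀ X : TraceClass H, X.toOp.IsPositive → (Φ X).IsPositive

/-- `Φ` is the six-term map with the real coefficients `μ₁, μ₂, μ₅, μ₆` and the complex
coefficients `μ₃ = conj μ₄`. -/
def HasHermitianForm (Φ : TraceClass H →L[ℂ] (HilbertTensor H →L[ℂ] HilbertTensor H))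
    (μ₁ μ₂ : ℝ) (μ₃ μ₄ : ℂ) (μ₅ μ₆ : ℝ) : Prop :=
  μ₃ = star μ₄ ∧
    ∀ X : TraceClass H, Φ X =
      (μ₁ : ℂ) • tensorOp 1 X.toOp + (μ₂ : ℂ) • tensorOp X.toOp 1
        + μ₃ • (swap H * tensorOp 1 X.toOp) + μ₄ • (swap H * tensorOp X.toOp 1)
        + ((μ₅ : ℂ) * X.trace) • tensorOp (1 : H →L[ℂ] H) 1 + ((μ₆ : ℂ) * X.trace) • swap H

/-- The conditions on the coefficients that characterize positivity. -/
def PositivityConditions (H : Type*) [NormedAddCommGroup H] [InnerProductSpace ℂ H]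
    (μ₁ μ₂ : ℝ) (μ₃ μ₄ : ℂ) (μ₅ μ₆ : ℝ) : Prop :=
  0 ≤ (μ₁ + μ₂ + μ₃ + μ₄ + μ₅ + μ₆ : ℂ) ∧
    (!![(μ₁ + μ₅ : ℂ), star μ₃ + μ₆; μ₃ + μ₆, (μ₂ + μ₅ : ℂ)]).PosSemidef ∧
    (3 ≤ Module.rank ℂ H → |μ₆| ≤ μ₅) ∧
    (Module.rank ℂ H = 2 → 0 ≤ μ₅ + μ₆)

end UnitaryCovariance

end

noncomputable section

namespace UnitaryCovariance

variable {H : Type*} [NormedAddCommGroup H] [InnerProductSpace ℂ H] [CompleteSpace H]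

/-! ## Elementary tensors and operators on the Hilbert space tensor product -/

/-! The finite sums of operators `|x⟩⟨x|` are dense in the trace class, up to complex coefficients
(`TraceClass.mem_of_rankOne_mem`), so a covariant continuous `Φ` is determined by `Φ(|e⟩⟨e|)` for
unit vectors `e`. That operator commutes with `U ⊗ U` for every unitary `U` fixing `e` up to a
phase.

Testing it on elementary tensors involves only `e`, one unit vector `f ⊥ e`, and one vector `w ⊥ e,
f`. A unitary that multiplies `e` and `f` by opposite phases and fixes `w` kills every matrix
coefficient except the diagonal ones and those linking `e ⊗ f` with `f ⊗ e`. Since unitaries act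
transitively on orthonormal pairs and triples, the survivors are constants. The one at `e ⊗ e`
follows from the others by rotating the plane of `e` and `f` (`IsCovariant.coeff_self_eq_zero`). Six
free numbers remain; choosing the coefficients of a six-term map to match them makes the difference
vanish (`IsCovariant.eq_zero`), whence `IsCovariant.exists_eq_sixTerm`.

Taking adjoints conjugates the six coefficients and exchanges the third with the fourth. A
Hermitian-preserving map thus has two representations, and their average has the required real form.
Averaging is needed because in dimension two the six terms satisfy the relation `(I - S)(X ⊗ I + I ⊗
X) = tr(X) (I - S)`, so coefficients cannot be compared.

For positivity, `Φ(|e⟩⟨e|)` is block diagonal. On `e ⊗ e` it is the sum of the coefficients; on the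
span of `e^⊥ ⊗ e` and `e ⊗ e^⊥`, identified by the swap, it is the 2×2 matrix; on `e^⊥ ⊗ e^⊥` it is
`μ₅ + μ₆ S`, with value `μ₅ + μ₆` on symmetric and `μ₅ - μ₆` on antisymmetric tensors. Antisymmetric
tensors of `e^⊥` exist exactly when the dimension is at least three, which explains the case
distinction. -/

/-- The elementary tensor `x ⊗ y` in the Hilbert space tensor product. -/
def tens (x y : H) : HilbertTensor H := ((x ⊗ₜ[ℂ] y : H ⊗[ℂ] H) : HilbertTensor H)

theorem tens_add_left (x x' y : H) : tens (x + x') y = tens x y + tens x' y := by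
  simp [tens, TensorProduct.add_tmul, UniformSpace.Completion.coe_add]

theorem tens_add_right (x y y' : H) : tens x (y + y') = tens x y + tens x y' := by
  simp [tens, TensorProduct.tmul_add, UniformSpace.Completion.coe_add]

theorem tens_smul_left (c : ℂ) (x y : H) : tens (c • x) y = c • tens x y := by
  rw [tens, ← TensorProduct.smul_tmul', UniformSpace.Completion.coe_smul, tens]

theorem tens_smul_right (c : ℂ) (x y : H) : tens x (c • y) = c • tens x y := by
  simp [tens]

theorem inner_tens (x y u v : H) : ⟪tens x y, tens u v⟫_ℂ = ⟪x, u⟫_ℂ * ⟪y, v⟫_ℂ := by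
  simp [tens]

theorem tensorOp_tens (A B : H →L[ℂ] H) (x y : H) :
    tensorOp A B (tens x y) = tens (A x) (B y) := tensorOp_tmul A B x y

theorem swap_tens (x y : H) : swap H (tens x y) = tens y x := swap_tmul x y

/-- Elementary tensors span the algebraic tensor product, which is dense in its completion. -/
theorem ext_tens {F : Type*} [NormedAddCommGroup F] [NormedSpace ℂ F]
    {A B : HilbertTensor H →L[ℂ] F} (h : ∀ x y, A (tens x y) = B (tens x y)) : A = B := by
  ext ξ
  induction ξ using UniformSpace.Completion.induction_on with
  | hp => exact isClosed_eq A.continuous B.continuous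
  | ih ξ =>
    induction ξ using TensorProduct.induction_on with
    | zero => rw [UniformSpace.Completion.coe_zero, map_zero, map_zero]
    | tmul x y => exact h x y
    | add a b ha hb => simp [UniformSpace.Completion.coe_add, ha, hb]

theorem eq_of_inner_tens {ξ η : HilbertTensor H}
    (h : ∀ x y, ⟪ξ, tens x y⟫_ℂ = ⟪η, tens x y⟫_ℂ) : ξ = η :=
  innerSL_inj (𝕜 := ℂ).1 (ext_tens h)

/-- An operator on the tensor product vanishes if its quadratic form does on elementary
tensors. -/
theorem eq_zero_of_inner_tens_self {D : HilbertTensor H →L[ℂ] HilbertTensor H}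
    (h : ∀ x y, ⟪tens x y, D (tens x y)⟫_ℂ = 0) : D = 0 := by
  -- Complex polarization one factor at a time: here the second factor, with the first one kept
  -- equal on both sides; `h2` then frees the first factor.
  have h1 : ∀ x y z, ⟪tens x y, D (tens x z)⟫_ℂ = 0 := fun x y z => by
    have e1 := h x (y + z)
    have e2 := h x (y + Complex.I • z)
    simp only [tens_add_right, tens_smul_right, map_add, map_smul, inner_add_left, inner_add_right,
      inner_smul_left, inner_smul_right, h, Complex.conj_I] at e1 e2
    linear_combination (1 / 2) * e1 - (Complex.I / 2) * e2 +
      (1 / 2) * (⟪tens x y, D (tens x z)⟫_ℂ - ⟪tens x z, D (tens x y)⟫_ℂ) * Complex.I_sq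
  have h2 : ∀ x y z w, ⟪tens x y, D (tens w z)⟫_ℂ = 0 := fun x y z w => by
    have e1 := h1 (x + w) y z
    have e2 := h1 (x + Complex.I • w) y z
    simp only [tens_add_left, tens_smul_left, map_add, map_smul, inner_add_left, inner_add_right,
      inner_smul_left, inner_smul_right, h1, Complex.conj_I] at e1 e2
    linear_combination (1 / 2) * e1 - (Complex.I / 2) * e2 +
      (1 / 2) * (⟪tens x y, D (tens w z)⟫_ℂ - ⟪tens w y, D (tens x z)⟫_ℂ) * Complex.I_sq
  refine ext_tens fun w z => eq_of_inner_tens fun x y => ?_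
  rw [← inner_conj_symm, h2]
  simp

theorem tensorOp_mul (A B A' B' : H →L[ℂ] H) :
    tensorOp A B * tensorOp A' B' = tensorOp (A * A') (B * B') :=
  ext_tens fun x y => by simp [tensorOp_tens]

theorem tensorOp_one : tensorOp (1 : H →L[ℂ] H) 1 = 1 :=
  ext_tens fun x y => by simp [tensorOp_tens]

theorem tensorOp_add_left (A A' B : H →L[ℂ] H) :
    tensorOp (A + A') B = tensorOp A B + tensorOp A' B :=
  ext_tens fun x y => by simp [tensorOp_tens, tens_add_left]

theorem tensorOp_add_right (A B B' : H →L[ℂ] H) :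
    tensorOp A (B + B') = tensorOp A B + tensorOp A B' :=
  ext_tens fun x y => by simp [tensorOp_tens, tens_add_right]

theorem tensorOp_smul_left (c : ℂ) (A B : H →L[ℂ] H) :
    tensorOp (c • A) B = c • tensorOp A B :=
  ext_tens fun x y => by simp [tensorOp_tens, tens_smul_left]

theorem tensorOp_smul_right (c : ℂ) (A B : H →L[ℂ] H) :
    tensorOp A (c • B) = c • tensorOp A B :=
  ext_tens fun x y => by simp [tensorOp_tens, tens_smul_right]

theorem star_op_add (A B : HilbertTensor H →L[ℂ] HilbertTensor H) :
    star (A + B) = star A + star B := star_add A B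

theorem star_op_sub (A B : HilbertTensor H →L[ℂ] HilbertTensor H) :
    star (A - B) = star A - star B := star_sub A B

theorem star_op_mul (A B : HilbertTensor H →L[ℂ] HilbertTensor H) :
    star (A * B) = star B * star A := star_mul A B

theorem star_op_smul (c : ℂ) (A : HilbertTensor H →L[ℂ] HilbertTensor H) :
    star (c • A) = star c • star A := star_smul c A

theorem star_op_star (A : HilbertTensor H →L[ℂ] HilbertTensor H) : star (star A) = A :=
  star_star A

theorem star_tensorOp (A B : H →L[ℂ] H) : star (tensorOp A B) = tensorOp (star A) (star B) := by
  refine ext_tens fun x y => eq_of_inner_tens fun u v => ?_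
  rw [ContinuousLinearMap.star_eq_adjoint, ContinuousLinearMap.adjoint_inner_left, tensorOp_tens,
    tensorOp_tens, inner_tens, inner_tens, ContinuousLinearMap.star_eq_adjoint,
    ContinuousLinearMap.star_eq_adjoint, ContinuousLinearMap.adjoint_inner_left,
    ContinuousLinearMap.adjoint_inner_left]

/-- Gives the continuity of `X ↦ I ⊗ X` and `X ↦ X ⊗ I` in the trace norm. By density the bound is
only needed on the algebraic tensor product. -/
theorem norm_tensorOp_le (A B : H →L[ℂ] H) : ‖tensorOp A B‖ ≤ ‖A‖ * ‖B‖ := by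
  refine ContinuousLinearMap.opNorm_le_bound _ (by positivity) fun ξ => ?_
  induction ξ using UniformSpace.Completion.induction_on with
  | hp => exact isClosed_le (by fun_prop) (by fun_prop)
  | ih ξ =>
    rw [tensorOp, ContinuousLinearMap.completion_apply_coe, UniformSpace.Completion.norm_coe,
      UniformSpace.Completion.norm_coe]
    exact (TensorProduct.mapL A B).le_of_opNorm_le (TensorProduct.norm_mapL_le A B) ξ

theorem star_swap : star (swap H) = swap H := by
  refine ext_tens fun x y => eq_of_inner_tens fun u v => ?_
  rw [ContinuousLinearMap.star_eq_adjoint, ContinuousLinearMap.adjoint_inner_left, swap_tens,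
    swap_tens, inner_tens, inner_tens, mul_comm]

theorem swap_mul_tensorOp (A B : H →L[ℂ] H) : swap H * tensorOp A B = tensorOp B A * swap H :=
  ext_tens fun x y => by simp [tensorOp_tens, swap_tens]

/-! ## Complex reflections -/

theorem exists_unitary_complexReflection {f : H} (hf : ‖f‖ = 1) {ζ : ℂ} (hζ : star ζ * ζ = 1) :
    ∃ U : unitary (H →L[ℂ] H), ∀ x, (U : H →L[ℂ] H) x = x + ((ζ - 1) * ⟪f, x⟫_ℂ) • f := by
  have hff : ⟪f, f⟫_ℂ = 1 := by
    rw [inner_self_eq_norm_sq_to_K, hf]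
    simp
  have hs : star (InnerProductSpace.rankOne ℂ f f) = InnerProductSpace.rankOne ℂ f f := by
    rw [ContinuousLinearMap.star_eq_adjoint, InnerProductSpace.adjoint_rankOne]
  refine ⟨⟨1 + (ζ - 1) • InnerProductSpace.rankOne ℂ f f, ?_⟩, fun x => by simp [mul_smul]⟩
  rw [Unitary.mem_iff, star_add, star_smul, hs, star_one]
  -- With `P = |f⟩⟨f|` idempotent, `(1 + aP)(1 + bP) = 1 + (a + b + ab)P`. For `a = ζ - 1` and `b =
  -- star ζ - 1` the bracket is `|ζ|² - 1`.
  have key : ∀ a b : ℂ, a + b + a * b = 0 →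
      (1 + a • InnerProductSpace.rankOne ℂ f f) * (1 + b • InnerProductSpace.rankOne ℂ f f) =
        (1 : H →L[ℂ] H) := fun a b hab => by
    ext x
    simp only [mul_apply_eq_comp, add_apply, one_apply_eq_self, smul_apply,
      InnerProductSpace.rankOne_apply, inner_add_right, inner_smul_right, hff]
    rw [add_assoc, ← sub_eq_zero, add_sub_cancel_left]
    simp only [smul_smul, ← add_smul]
    rw [show b * ⟪f, x⟫_ℂ + a * (⟪f, x⟫_ℂ + b * (⟪f, x⟫_ℂ * 1)) =
      (a + b + a * b) * ⟪f, x⟫_ℂ by ring, hab, zero_mul, zero_smul]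
  constructor
  · refine key _ _ ?_
    rw [star_sub, star_one]
    linear_combination hζ
  · refine key _ _ ?_
    rw [star_sub, star_one]
    linear_combination hζ

/-- The unitary group acts transitively on the unit sphere, by complex reflections. -/
theorem exists_unitary_map_eq {x y : H} (hx : ‖x‖ = 1) (hy : ‖y‖ = 1) :
    ∃ U : unitary (H →L[ℂ] H), (U : H →L[ℂ] H) x = y ∧
      ∀ v, ⟪x - y, v⟫_ℂ = 0 → (U : H →L[ℂ] H) v = v := by
  by_cases hxy : x = y
  · exact ⟨1, by simpa using hxy, by simp⟩
  have hn : ‖x - y‖ ≠ 0 := norm_ne_zero_iff.2 (sub_ne_zero.2 hxy)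
  have hxx : ⟪x, x⟫_ℂ = 1 := by
    rw [inner_self_eq_norm_sq_to_K, hx]; simp
  have hyy : ⟪y, y⟫_ℂ = 1 := by
    rw [inner_self_eq_norm_sq_to_K, hy]; simp
  set t := ⟪y, x⟫_ℂ with ht
  have ht' : ⟪x, y⟫_ℂ = star t := (inner_conj_symm x y).symm
  have hN : ((‖x - y‖ : ℂ)) ^ 2 = 2 - t - star t := by
    have := inner_self_eq_norm_sq_to_K (𝕜 := ℂ) (x - y)
    simp only [inner_sub_left, inner_sub_right, hxx, hyy, ht', ← ht] at this
    simp only [Complex.coe_algebraMap] at this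
    rw [← this]
    ring
  have h1t : 1 - t ≠ 0 := fun h => by
    have h' : t = 1 := (sub_eq_zero.1 h).symm
    rw [h', star_one] at hN
    apply hn
    have : ((‖x - y‖ : ℂ)) ^ 2 = 0 := by rw [hN]; ring
    exact_mod_cast pow_eq_zero_iff two_ne_zero |>.1 this
  have h1t' : 1 - star t ≠ 0 := fun h => h1t (by
    have := congrArg star h
    simpa using this)
  have hfn : ‖((‖x - y‖ : ℂ)⁻¹) • (x - y)‖ = 1 := by
    rw [norm_smul, norm_inv, Complex.norm_real, norm_norm, inv_mul_cancel₀ hn]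
  -- Reflecting along `x - y` sends `x` to `y` exactly when `(ζ - 1)(1 - t) = -‖x - y‖² = -(2 - t -
  -- star t)`. This forces the value of `ζ`, which has modulus one.
  obtain ⟨U, hU⟩ := exists_unitary_complexReflection (ζ := -(1 - star t) / (1 - t)) hfn (by
    rw [star_div₀, star_neg, star_sub, star_sub, star_one, star_star]
    field_simp)
  have hU' : ∀ v, (U : H →L[ℂ] H) v =
      v + ((-(1 - star t) / (1 - t) - 1) * ⟪x - y, v⟫_ℂ * (((‖x - y‖ : ℂ)) ^ 2)⁻¹) • (x - y) :=
    fun v => by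
      rw [hU, inner_smul_left, smul_smul, map_inv₀, Complex.conj_ofReal]
      congr 2
      ring
  refine ⟨U, ?_, fun v hv => by rw [hU', hv]; simp⟩
  have hc : (-(1 - star t) / (1 - t) - 1) * ⟪x - y, x⟫_ℂ * (((‖x - y‖ : ℂ)) ^ 2)⁻¹ = -1 := by
    have hN0 : 2 - t - star t ≠ 0 := by
      rw [← hN]
      exact pow_ne_zero 2 (by exact_mod_cast hn)
    rw [inner_sub_left, hxx, ← ht, hN]
    field_simp
    ring
  rw [hU', hc, neg_one_smul]
  abel

theorem norm_unitary_apply (U : unitary (H →L[ℂ] H)) (x : H) : ‖(U : H →L[ℂ] H) x‖ = ‖x‖ :=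
  ContinuousLinearMap.norm_map_of_mem_unitary U.2 x

theorem inner_unitary_apply (U : unitary (H →L[ℂ] H)) (x y : H) :
    ⟪(U : H →L[ℂ] H) x, (U : H →L[ℂ] H) y⟫_ℂ = ⟪x, y⟫_ℂ := by
  rw [← ContinuousLinearMap.adjoint_inner_left, ← ContinuousLinearMap.star_eq_adjoint,
    ← mul_apply_eq_comp, Unitary.coe_star_mul_self, one_apply_eq_self]

/-- The unitary group acts transitively on orthonormal pairs, and the unitary can be chosen to fix
the vectors orthogonal to both pairs. -/
theorem exists_unitary_map_pair_eq {x y x' y' : H} (hx : ‖x‖ = 1) (hy : ‖y‖ = 1)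
    (hxy : ⟪x, y⟫_ℂ = 0) (hx' : ‖x'‖ = 1) (hy' : ‖y'‖ = 1) (hxy' : ⟪x', y'⟫_ℂ = 0) :
    ∃ U : unitary (H →L[ℂ] H), (U : H →L[ℂ] H) x = x' ∧ (U : H →L[ℂ] H) y = y' ∧
      ∀ v, ⟪x, v⟫_ℂ = 0 → ⟪y, v⟫_ℂ = 0 → ⟪x', v⟫_ℂ = 0 → ⟪y', v⟫_ℂ = 0 →
        (U : H →L[ℂ] H) v = v := by
  obtain ⟨U, hU, hUf⟩ := exists_unitary_map_eq hx hx'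
  obtain ⟨V, hV, hVf⟩ := exists_unitary_map_eq (x := (U : H →L[ℂ] H) y) (y := y')
    (by rw [norm_unitary_apply, hy]) hy'
  refine ⟨V * U, ?_, ?_, fun v h1 h2 h3 h4 => ?_⟩
  -- Both `U y` and `y'` are orthogonal to `x' = U x`, so the second reflection does not move `x'`.
  · have : ⟪(U : H →L[ℂ] H) y, x'⟫_ℂ = 0 := by
      rw [← hU, inner_unitary_apply, inner_eq_zero_symm, hxy]
    simp only [Submonoid.coe_mul, mul_apply_eq_comp, hU]
    exact hVf _ (by rw [inner_sub_left, this, inner_eq_zero_symm.1 hxy', sub_zero])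
  · simp only [Submonoid.coe_mul, mul_apply_eq_comp, hV]
  · have hUv : (U : H →L[ℂ] H) v = v := hUf v (by rw [inner_sub_left, h1, h3, sub_zero])
    simp only [Submonoid.coe_mul, mul_apply_eq_comp, hUv]
    refine hVf v ?_
    rw [inner_sub_left, h4, sub_zero]
    conv_lhs => rw [← hUv]
    rw [inner_unitary_apply, h2]

/-! ## Rank one operators are total in the trace class -/

/-- The diagonal entries are products of Fourier coefficients of two fixed vectors; the inequality
`ab ≤ (a² + b²)/2` and Parseval bound their sum. -/
theorem traceNorm_rankOne_lt_top (x y : H) :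
    traceNorm (InnerProductSpace.rankOne ℂ x y) < ⊤ := by
  obtain ⟨V, -, h⟩ := traceNorm_le_tsum_inner (InnerProductSpace.rankOne ℂ x y)
  have key : ∀ i, ‖⟪V (stdBasis H i), InnerProductSpace.rankOne ℂ x y (stdBasis H i)⟫_ℂ‖ₑ ≤
      2⁻¹ * (‖⟪stdBasis H i, y⟫_ℂ‖ₑ ^ 2 + ‖⟪stdBasis H i, star V x⟫_ℂ‖ₑ ^ 2) := fun i => by
    rw [InnerProductSpace.rankOne_apply, inner_smul_right, enorm_mul,
      ContinuousLinearMap.star_eq_adjoint, ContinuousLinearMap.adjoint_inner_right,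
      ← inner_conj_symm y, RCLike.enorm_conj]
    exact enorm_mul_le_half_sq _ _
  refine (h.trans (ENNReal.tsum_le_tsum key)).trans_lt ?_
  rw [ENNReal.tsum_mul_left, ENNReal.tsum_add, parseval, parseval]
  exact ENNReal.mul_lt_top (by simp) (ENNReal.add_lt_top.2 ⟨by simp, by simp⟩)

/-- The trace norm dominates the operator norm: with `R = |T|^(1/2)`, the trace norm is the squared
Hilbert–Schmidt norm of `R`, which bounds `‖R‖²`, and `‖T x‖ = ‖R (R x)‖`. -/
theorem enorm_apply_le_traceNorm (T : H →L[ℂ] H) (x : H) : ‖T x‖ₑ ≤ traceNorm T * ‖x‖ₑ := by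
  set R := CFC.sqrt (CFC.abs T) with hR
  have hRs : star R = R := (IsSelfAdjoint.of_nonneg (CFC.sqrt_nonneg _)).star_eq
  have hRR : R * R = CFC.abs T := CFC.sqrt_mul_sqrt_self _ (CFC.abs_nonneg _)
  have hsq : ∀ z, ‖R z‖ₑ ^ 2 ≤ traceNorm T * ‖z‖ₑ ^ 2 := fun z => by
    rw [← parseval (stdBasis H) (R z), traceNorm_eq_sqrt (stdBasis H), ← ENNReal.tsum_mul_right]
    refine ENNReal.tsum_le_tsum fun i => ?_
    rw [← mul_pow, ← hR]
    gcongr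
    conv_lhs => rw [← hRs, ContinuousLinearMap.star_eq_adjoint,
      ContinuousLinearMap.adjoint_inner_right]
    rw [← ofReal_norm, ← ofReal_norm, ← ofReal_norm, ← ENNReal.ofReal_mul (norm_nonneg _)]
    exact ENNReal.ofReal_le_ofReal (norm_inner_le_norm _ _)
  have h1 : ‖T x‖ₑ = ‖R (R x)‖ₑ := by
    rw [← mul_apply_eq_comp, hRR, ← ofReal_norm, ← ofReal_norm, norm_abs_apply]
  have h2 : ‖T x‖ₑ ^ 2 ≤ (traceNorm T * ‖x‖ₑ) ^ 2 := by
    rw [h1]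
    calc ‖R (R x)‖ₑ ^ 2 ≤ traceNorm T * ‖R x‖ₑ ^ 2 := hsq _
      _ ≤ traceNorm T * (traceNorm T * ‖x‖ₑ ^ 2) := by gcongr; exact hsq _
      _ = (traceNorm T * ‖x‖ₑ) ^ 2 := by ring
  exact (ENNReal.pow_right_strictMono two_ne_zero).le_iff_le.1 h2

namespace TraceClass

/-- The operator `|x⟩⟨y|` as a trace class operator. -/
def rankOne (x y : H) : TraceClass H :=
  ofOp (InnerProductSpace.rankOne ℂ x y) (traceNorm_rankOne_lt_top x y)

@[simp]
theorem toOp_rankOne (x y : H) : (rankOne x y).toOp = InnerProductSpace.rankOne ℂ x y := rfl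

theorem trace_rankOne (x y : H) : (rankOne x y).trace = ⟪y, x⟫_ℂ := by
  refine (hasSum_trace (stdBasis H) (rankOne x y)).unique ?_
  simpa [inner_smul_right] using (stdBasis H).hasSum_inner_mul_inner y x

theorem rankOne_add_left (x x' y : H) : rankOne (x + x') y = rankOne x y + rankOne x' y :=
  TraceClass.ext (by simp)

theorem rankOne_add_right (x y y' : H) : rankOne x (y + y') = rankOne x y + rankOne x y' :=
  TraceClass.ext (by simp)

theorem rankOne_smul_left (c : ℂ) (x y : H) : rankOne (c • x) y = c • rankOne x y :=
  TraceClass.ext (by simp)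

theorem rankOne_smul_right (c : ℂ) (x y : H) : rankOne x (c • y) = star c • rankOne x y :=
  TraceClass.ext (by simp)

theorem conj_rankOne (U : unitary (H →L[ℂ] H)) (x y : H) :
    conj U (rankOne x y) = rankOne ((U : H →L[ℂ] H) x) ((U : H →L[ℂ] H) y) := by
  refine TraceClass.ext ?_
  ext z
  simp [ContinuousLinearMap.star_eq_adjoint, ContinuousLinearMap.adjoint_inner_right]

theorem star_rankOne (x y : H) : star (rankOne x y) = rankOne y x :=
  TraceClass.ext (by simp [ContinuousLinearMap.star_eq_adjoint])

theorem norm_toOp_le (X : TraceClass H) : ‖X.toOp‖ ≤ ‖X‖ := by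
  refine ContinuousLinearMap.opNorm_le_bound _ (norm_nonneg _) fun x => ?_
  have h := ENNReal.toReal_mono (ENNReal.mul_lt_top X.traceNorm_lt_top enorm_lt_top).ne
    (enorm_apply_le_traceNorm X.toOp x)
  simpa [norm_def] using h

/-- The inclusion of the trace class into the bounded operators is continuous. -/
def toOpL (H : Type*) [NormedAddCommGroup H] [InnerProductSpace ℂ H] [CompleteSpace H] :
    TraceClass H →L[ℂ] (H →L[ℂ] H) :=
  LinearMap.mkContinuous ⟨⟨toOp, toOp_add⟩, toOp_smul⟩ 1 fun X => by
    rw [one_mul]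
    exact norm_toOp_le X

@[simp]
theorem toOpL_apply (X : TraceClass H) : toOpL H X = X.toOp := rfl

/-- The trace as a continuous linear functional. -/
def traceL (H : Type*) [NormedAddCommGroup H] [InnerProductSpace ℂ H] [CompleteSpace H] :
    TraceClass H →L[ℂ] ℂ :=
  LinearMap.mkContinuous
    ⟨⟨trace, fun X Y => (hasSum_trace (stdBasis H) (X + Y)).unique (by
        simpa [inner_add_right] using
          (hasSum_trace (stdBasis H) X).add (hasSum_trace (stdBasis H) Y))⟩,
      fun c X => (hasSum_trace (stdBasis H) (c • X)).unique (by
        simpa [inner_smul_right] using (hasSum_trace (stdBasis H) X).mul_left c)⟩ 1 fun X => by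
    rw [one_mul]
    refine (norm_tsum_le_tsum_norm (summable_norm_inner (stdBasis H) X)).trans ?_
    have h := tsum_inner_le (stdBasis H) X.toOp 1 1 (fun x => le_rfl) fun x => le_rfl
    have h2 := ENNReal.toReal_mono X.traceNorm_lt_top.ne h
    rw [ENNReal.tsum_toReal_eq fun i => enorm_ne_top] at h2
    simpa [norm_def] using h2

@[simp]
theorem traceL_apply (X : TraceClass H) : traceL H X = X.trace := rfl

/-! ### Rank one expansions converging in the trace norm. -/

theorem traceNorm_star_mul_self (A : H →L[ℂ] H) :
    traceNorm (star A * A) = ∑' i, ‖A (stdBasis H i)‖ₑ ^ 2 := by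
  rw [traceNorm]
  refine tsum_congr fun i => ?_
  rw [CFC.abs_of_nonneg _ (star_mul_self_nonneg A), mul_apply_eq_comp,
    ContinuousLinearMap.star_eq_adjoint, ContinuousLinearMap.adjoint_inner_right,
    inner_self_eq_norm_sq, ENNReal.ofReal_pow (norm_nonneg _), ofReal_norm]

/-- Expansion of a trace class operator in a series of rank one operators converging in the trace
norm. -/
theorem hasSum_rankOne (X : TraceClass H) (V R : H →L[ℂ] H) (hV : ∀ x, ‖V x‖ ≤ ‖x‖)
    (hR : star R = R) (hX : X.toOp = V * (R * R))
    (hsum : ∑' i, ‖R (stdBasis H i)‖ₑ ^ 2 ≠ ⊤) :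
    HasSum (fun i => rankOne (V (R (stdBasis H i))) (R (stdBasis H i))) X := by
  classical
  set b := stdBasis H with hb
  rw [HasSum, tendsto_iff_norm_sub_tendsto_zero]
  have hlim : Filter.Tendsto
      (fun F : Finset (BasisIndex H) => (∑' i : {i // i ∉ F}, ‖R (b i)‖ₑ ^ 2).toReal)
      Filter.atTop (nhds 0) := by
    have := ENNReal.tendsto_tsum_compl_atTop_zero hsum
    exact (ENNReal.tendsto_toReal ENNReal.zero_ne_top).comp this
  refine squeeze_zero (fun _ => norm_nonneg _) (fun F => ?_) hlim
  rw [norm_sub_rev, norm_def]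
  refine ENNReal.toReal_mono (ne_top_of_le_ne_top hsum (ENNReal.tsum_comp_le_tsum_of_injective
    Subtype.val_injective (fun i => ‖R (b i)‖ₑ ^ 2))) ?_
  -- `G` projects onto the complement of the span of the `b i`, `i ∈ F`. The remainder after the
  -- partial sum over `F` is `V R G R = V (G R)* (G R)`, whose trace norm is at most the squared
  -- Hilbert–Schmidt norm of `G R`.
  set G : H →L[ℂ] H := 1 - ∑ i ∈ F, InnerProductSpace.rankOne ℂ (b i) (b i) with hG
  have hGs : star G = G := by
    simp [hG, star_sum, ContinuousLinearMap.star_eq_adjoint]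
  have hGb : ∀ j, G (b j) = if j ∈ F then 0 else b j := fun j => by
    have hin : ∀ i, ⟪b i, b j⟫_ℂ = if i = j then 1 else 0 := fun i =>
      orthonormal_iff_ite.1 b.orthonormal i j
    have : ∑ i ∈ F, ⟪b i, b j⟫_ℂ • b i = if j ∈ F then b j else 0 := by
      simp [hin]
    simp only [hG, sub_apply, one_apply_eq_self, sum_apply,
      InnerProductSpace.rankOne_apply, this]
    split_ifs <;> simp
  have hGG : G * G = G := by
    have h0 : G * ∑ i ∈ F, InnerProductSpace.rankOne ℂ (b i) (b i) = 0 := by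
      ext z
      simp only [mul_apply_eq_comp, sum_apply, InnerProductSpace.rankOne_apply, map_sum, map_smul,
        zero_apply]
      refine Finset.sum_eq_zero fun i hi => ?_
      rw [hGb, if_pos hi, smul_zero]
    conv_lhs => rw [hG, ← hG]
    conv_lhs => enter [2]; rw [hG]
    rw [mul_sub, h0, mul_one, sub_zero]
  have hop : (X - ∑ i ∈ F, rankOne (V (R (b i))) (R (b i))).toOp =
      V * (star (G * R) * (G * R)) * 1 := by
    rw [← toOpL_apply, map_sub, map_sum]
    simp only [toOpL_apply, hX, star_mul, hR, hGs, toOp_rankOne]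
    rw [mul_one, mul_assoc R G, ← mul_assoc G G R, hGG, hG]
    ext z
    simp only [sub_apply, mul_apply_eq_comp, sum_apply, InnerProductSpace.rankOne_apply, map_sub,
      map_sum, map_smul, one_apply_eq_self]
    congr 1
    refine Finset.sum_congr rfl fun i _ => ?_
    rw [← ContinuousLinearMap.adjoint_inner_left, ← ContinuousLinearMap.star_eq_adjoint, hR]
  rw [hop]
  refine (traceNorm_mul_mul_le _ _ _ hV fun x => le_rfl).trans (le_of_eq ?_)
  -- Passing to the adjoint `R G` lets `G` act on basis vectors first, so exactly the terms with `i
  -- ∉ F` survive: a tail of a convergent series.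
  rw [traceNorm_star_mul_self, tsum_sq_adjoint b b, star_mul, hR, hGs]
  refine Eq.trans (tsum_congr fun i => ?_)
    (tsum_subtype {i | i ∉ F} fun i => ‖R (b i)‖ₑ ^ 2).symm
  rw [mul_apply_eq_comp, hGb, Set.indicator_apply]
  by_cases h : i ∈ F
  · rw [if_pos h, if_neg (fun h' => h' h)]
    simp
  · rw [if_neg h, if_pos (show i ∈ {i | i ∉ F} from h)]

theorem hasSum_rankOne_of_isPositive (X : TraceClass H) (hX : X.toOp.IsPositive) :
    HasSum (fun i => rankOne (CFC.sqrt X.toOp (stdBasis H i)) (CFC.sqrt X.toOp (stdBasis H i)))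
      X := by
  have hX0 : 0 ≤ X.toOp := (ContinuousLinearMap.nonneg_iff_isPositive _).2 hX
  have hab : CFC.abs X.toOp = X.toOp := CFC.abs_of_nonneg _ hX0
  refine hasSum_rankOne X 1 (CFC.sqrt X.toOp) (fun x => le_rfl)
    (IsSelfAdjoint.of_nonneg (CFC.sqrt_nonneg _)).star_eq
    (by rw [one_mul, CFC.sqrt_mul_sqrt_self _ hX0]) ?_
  have := X.traceNorm_lt_top.ne
  rwa [traceNorm_eq_sqrt (stdBasis H), hab] at this

/-- A closed subspace of the trace class which contains all rank one operators `|x⟩⟨x|` is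
everything. -/
theorem mem_of_rankOne_mem (S : Submodule ℂ (TraceClass H)) (hS : IsClosed (S : Set (TraceClass H)))
    (h : ∀ x, rankOne x x ∈ S) (X : TraceClass H) : X ∈ S := by
  -- Polarization: `x + y` yields `|x⟩⟨y| + |y⟩⟨x|`, and `x + iy` yields, after multiplication by
  -- `i`, `|x⟩⟨y| - |y⟩⟨x|`.
  have h2 : ∀ x y, rankOne x y ∈ S := fun x y => by
    have e1 := h (x + y)
    have e2 := h (x + Complex.I • y)
    simp only [rankOne_add_left, rankOne_add_right, rankOne_smul_left, rankOne_smul_right] at e1 e2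
    have e1' : rankOne x y + rankOne y x ∈ S := by
      have := S.sub_mem (S.sub_mem e1 (h x)) (h y)
      convert this using 1
      abel
    have e2' : rankOne x y - rankOne y x ∈ S := by
      have := S.smul_mem Complex.I (S.sub_mem (S.sub_mem e2 (h x)) (h y))
      convert this using 1
      have hI : ∀ Z : TraceClass H, Complex.I • Complex.I • Z = -Z := fun Z => by
        rw [smul_smul, Complex.I_mul_I, neg_one_smul]
      have hI' : star Complex.I = -Complex.I := Complex.conj_I
      simp only [smul_add, smul_sub, hI, hI', neg_smul, smul_neg, neg_neg]
      abel
    have := S.smul_mem (2⁻¹ : ℂ) (S.add_mem e1' e2')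
    convert this using 1
    rw [add_add_sub_cancel, ← two_smul ℂ, smul_smul, inv_mul_cancel₀ two_ne_zero, one_smul]
  obtain ⟨V, hV, -, hXV, -⟩ := exists_polar X.toOp
  have hs := hasSum_rankOne X V (CFC.sqrt (CFC.abs X.toOp)) hV
    (IsSelfAdjoint.of_nonneg (CFC.sqrt_nonneg _)).star_eq
    (by rw [CFC.sqrt_mul_sqrt_self _ (CFC.abs_nonneg _), ← hXV])
    (by rw [← traceNorm_eq_sqrt]; exact X.traceNorm_lt_top.ne)
  exact hS.mem_of_tendsto hs (Filter.Eventually.of_forall fun F =>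
    S.sum_mem fun i _ => h2 _ _)

end TraceClass

/-! ## The six-term maps -/

/-- The map `X ↦ I ⊗ X` on the trace class. -/
def oneTensorL (H : Type*) [NormedAddCommGroup H] [InnerProductSpace ℂ H] [CompleteSpace H] :
    TraceClass H →L[ℂ] (HilbertTensor H →L[ℂ] HilbertTensor H) :=
  LinearMap.mkContinuous
    { toFun := fun X => tensorOp 1 X.toOp
      map_add' := fun X Y => by rw [TraceClass.toOp_add, tensorOp_add_right]
      map_smul' := fun c X => by rw [TraceClass.toOp_smul, tensorOp_smul_right, RingHom.id_apply] }
    ‖(1 : H →L[ℂ] H)‖ fun X => (norm_tensorOp_le _ _).trans <| by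
      gcongr
      exact X.norm_toOp_le

/-- The map `X ↦ X ⊗ I` on the trace class. -/
def tensorOneL (H : Type*) [NormedAddCommGroup H] [InnerProductSpace ℂ H] [CompleteSpace H] :
    TraceClass H →L[ℂ] (HilbertTensor H →L[ℂ] HilbertTensor H) :=
  LinearMap.mkContinuous
    { toFun := fun X => tensorOp X.toOp 1
      map_add' := fun X Y => by rw [TraceClass.toOp_add, tensorOp_add_left]
      map_smul' := fun c X => by rw [TraceClass.toOp_smul, tensorOp_smul_left, RingHom.id_apply] }
    ‖(1 : H →L[ℂ] H)‖ fun X => (norm_tensorOp_le _ _).trans <| by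
      rw [mul_comm]
      gcongr
      exact X.norm_toOp_le

theorem oneTensorL_apply (X : TraceClass H) : oneTensorL H X = tensorOp 1 X.toOp := rfl

theorem tensorOneL_apply (X : TraceClass H) : tensorOneL H X = tensorOp X.toOp 1 := rfl

/-- The six-term map with complex coefficients. -/
def sixTerm (H : Type*) [NormedAddCommGroup H] [InnerProductSpace ℂ H] [CompleteSpace H]
    (m₁ m₂ m₃ m₄ m₅ m₆ : ℂ) : TraceClass H →L[ℂ] (HilbertTensor H →L[ℂ] HilbertTensor H) :=
  m₁ • oneTensorL H + m₂ • tensorOneL H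
    + m₃ • (ContinuousLinearMap.mul ℂ (HilbertTensor H →L[ℂ] HilbertTensor H) (swap H) ∘L
      oneTensorL H)
    + m₄ • (ContinuousLinearMap.mul ℂ (HilbertTensor H →L[ℂ] HilbertTensor H) (swap H) ∘L
      tensorOneL H)
    + m₅ • (TraceClass.traceL H).smulRight (tensorOp (1 : H →L[ℂ] H) 1)
    + m₆ • (TraceClass.traceL H).smulRight (swap H)

theorem sixTerm_apply (m₁ m₂ m₃ m₄ m₅ m₆ : ℂ) (X : TraceClass H) :
    sixTerm H m₁ m₂ m₃ m₄ m₅ m₆ X =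
      m₁ • tensorOp 1 X.toOp + m₂ • tensorOp X.toOp 1
        + m₃ • (swap H * tensorOp 1 X.toOp) + m₄ • (swap H * tensorOp X.toOp 1)
        + (m₅ * X.trace) • tensorOp (1 : H →L[ℂ] H) 1 + (m₆ * X.trace) • swap H := by
  simp [sixTerm, oneTensorL_apply, tensorOneL_apply, smul_smul]

theorem hasHermitianForm_iff
    {Φ : TraceClass H →L[ℂ] (HilbertTensor H →L[ℂ] HilbertTensor H)}
    {μ₁ μ₂ : ℝ} {μ₃ μ₄ : ℂ} {μ₅ μ₆ : ℝ} :
    HasHermitianForm Φ μ₁ μ₂ μ₃ μ₄ μ₅ μ₆ ↔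
      μ₃ = star μ₄ ∧ Φ = sixTerm H μ₁ μ₂ μ₃ μ₄ μ₅ μ₆ := by
  refine and_congr_right fun _ => ?_
  rw [ContinuousLinearMap.ext_iff]
  simp only [sixTerm_apply]

/-! ### Matrix coefficients and covariance. -/

/-- The matrix coefficient `⟨u ⊗ v, Φ(|x⟩⟨x|) (w ⊗ z)⟩`. -/
def coeff (Φ : TraceClass H →L[ℂ] (HilbertTensor H →L[ℂ] HilbertTensor H)) (x u v w z : H) : ℂ :=
  ⟪tens u v, Φ (TraceClass.rankOne x x) (tens w z)⟫_ℂ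

/-- On orthonormal vectors every bracket is 0 or 1, so this becomes the linear system that
determines the six coefficients, and later the table of values for the positivity tests. -/
theorem coeff_sixTerm (m₁ m₂ m₃ m₄ m₅ m₆ : ℂ) (x u v w z : H) :
    coeff (sixTerm H m₁ m₂ m₃ m₄ m₅ m₆) x u v w z =
      m₁ * (⟪u, w⟫_ℂ * (⟪x, z⟫_ℂ * ⟪v, x⟫_ℂ)) + m₂ * (⟪x, w⟫_ℂ * ⟪u, x⟫_ℂ * ⟪v, z⟫_ℂ)
        + m₃ * (⟪x, z⟫_ℂ * ⟪u, x⟫_ℂ * ⟪v, w⟫_ℂ) + m₄ * (⟪u, z⟫_ℂ * (⟪x, w⟫_ℂ * ⟪v, x⟫_ℂ))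
        + m₅ * ⟪x, x⟫_ℂ * (⟪u, w⟫_ℂ * ⟪v, z⟫_ℂ) + m₆ * ⟪x, x⟫_ℂ * (⟪u, z⟫_ℂ * ⟪v, w⟫_ℂ) := by
  simp only [coeff, sixTerm_apply, add_apply, smul_apply, mul_apply_eq_comp, tensorOp_tens,
    swap_tens, inner_add_right, inner_smul_right, inner_tens, TraceClass.trace_rankOne,
    TraceClass.toOp_rankOne, InnerProductSpace.rankOne_apply, one_apply_eq_self]

/-- Both sides are continuous and linear in `X` and agree on the total family `|x⟩⟨x|`. -/
theorem TraceClass.trace_conj (U : unitary (H →L[ℂ] H)) (X : TraceClass H) :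
    (TraceClass.conj U X).trace = X.trace := by
  let L : TraceClass H →ₗ[ℂ] TraceClass H :=
    ⟨⟨TraceClass.conj U, fun X Y => TraceClass.ext (by simp [mul_add, add_mul])⟩,
      fun c X => TraceClass.ext (by simp)⟩
  have hL : ∀ X, ‖L X‖ ≤ 1 * ‖X‖ := fun X => by
    rw [one_mul]
    exact ENNReal.toReal_mono X.traceNorm_lt_top.ne
      (traceNorm_mul_mul_le _ _ _ (fun x => (norm_unitary_apply U x).le)
        fun x => (norm_unitary_apply (star U) x).le)
  have h := TraceClass.mem_of_rankOne_mem
    (LinearMap.ker (((TraceClass.traceL H) ∘L L.mkContinuous 1 hL - TraceClass.traceL H :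
      TraceClass H →L[ℂ] ℂ) : TraceClass H →ₗ[ℂ] ℂ))
    (ContinuousLinearMap.isClosed_ker _) (fun x => by
      show (TraceClass.conj U (TraceClass.rankOne x x)).trace - (TraceClass.rankOne x x).trace = 0
      rw [TraceClass.conj_rankOne, TraceClass.trace_rankOne, TraceClass.trace_rankOne,
        inner_unitary_apply, sub_self]) X
  exact sub_eq_zero.1 h

theorem isCovariant_sixTerm (m₁ m₂ m₃ m₄ m₅ m₆ : ℂ) :
    IsCovariant (sixTerm H m₁ m₂ m₃ m₄ m₅ m₆) := fun U X => by
  refine ext_tens fun x y => ?_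
  have h : ∀ z, (U : H →L[ℂ] H) (star (U : H →L[ℂ] H) z) = z := fun z => by
    rw [← mul_apply_eq_comp, Unitary.mul_star_self_of_mem U.2, one_apply_eq_self]
  simp only [sixTerm_apply, add_apply, smul_apply, mul_apply_eq_comp, tensorOp_tens, swap_tens,
    TraceClass.toOp_conj, one_apply_eq_self, TraceClass.trace_conj, map_add, map_smul, h]

theorem IsCovariant.sub {Φ Ψ : TraceClass H →L[ℂ] (HilbertTensor H →L[ℂ] HilbertTensor H)}
    (hΦ : IsCovariant Φ) (hΨ : IsCovariant Ψ) : IsCovariant (Φ - Ψ) := fun U X => by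
  rw [sub_apply, sub_apply, hΦ, hΨ, mul_sub, sub_mul]

variable {Φ : TraceClass H →L[ℂ] (HilbertTensor H →L[ℂ] HilbertTensor H)}

theorem IsCovariant.inner_conj (hΦ : IsCovariant Φ) (U : unitary (H →L[ℂ] H)) (X : TraceClass H)
    (ξ η : HilbertTensor H) :
    ⟪tensorOp (U : H →L[ℂ] H) (U : H →L[ℂ] H) ξ,
      Φ (TraceClass.conj U X) (tensorOp (U : H →L[ℂ] H) (U : H →L[ℂ] H) η)⟫_ℂ =
        ⟪ξ, Φ X η⟫_ℂ := by
  have h : ∀ ζ, tensorOp (star (U : H →L[ℂ] H)) (star (U : H →L[ℂ] H))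
      (tensorOp (U : H →L[ℂ] H) (U : H →L[ℂ] H) ζ) = ζ := fun ζ => by
    rw [← mul_apply_eq_comp, tensorOp_mul, Unitary.coe_star_mul_self, tensorOp_one,
      one_apply_eq_self]
  rw [hΦ, mul_apply_eq_comp, mul_apply_eq_comp, h, ← ContinuousLinearMap.adjoint_inner_left,
    ← ContinuousLinearMap.star_eq_adjoint, star_tensorOp, h]

theorem IsCovariant.coeff_map (hΦ : IsCovariant Φ) (U : unitary (H →L[ℂ] H)) (x u v w z : H) :
    coeff Φ ((U : H →L[ℂ] H) x) ((U : H →L[ℂ] H) u) ((U : H →L[ℂ] H) v) ((U : H →L[ℂ] H) w)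
      ((U : H →L[ℂ] H) z) = coeff Φ x u v w z := by
  rw [coeff, ← TraceClass.conj_rankOne, ← tensorOp_tens, ← tensorOp_tens, hΦ.inner_conj, coeff]

/-! ## Covariant maps are six-term maps -/

theorem inner_self_of_norm_eq_one {x : H} (hx : ‖x‖ = 1) : ⟪x, x⟫_ℂ = 1 := by
  rw [inner_self_eq_norm_sq_to_K, hx]
  simp

/-- The span of `S` is finite-dimensional of too small a rank to be everything, so its orthogonal
complement is nonzero. -/
theorem exists_norm_eq_one_inner_eq_zero (S : Finset H) (h : (S.card : Cardinal) < Module.rank ℂ H) :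
    ∃ v : H, ‖v‖ = 1 ∧ ∀ x ∈ S, ⟪x, v⟫_ℂ = 0 := by
  set W := Submodule.span ℂ (S : Set H) with hW
  have : FiniteDimensional ℂ W := FiniteDimensional.span_finset ℂ S
  have hne : W ≠ ⊤ := fun htop => by
    have h1 : Module.rank ℂ W ≤ S.card := by
      simpa using rank_span_le (R := ℂ) (S : Set H)
    rw [htop, rank_top] at h1
    exact absurd h (not_lt.2 h1)
  have hbot : Wᗮ ≠ ⊥ := fun hb => hne (Submodule.orthogonal_eq_bot_iff.1 hb)
  obtain ⟨w, hw, hw0⟩ := Submodule.exists_mem_ne_zero_of_ne_bot hbot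
  refine ⟨((‖w‖ : ℂ)⁻¹) • w, ?_, fun x hx => ?_⟩
  · rw [norm_smul, norm_inv, Complex.norm_real, norm_norm, inv_mul_cancel₀ (norm_ne_zero_iff.2 hw0)]
  · rw [inner_smul_right, hw x (Submodule.subset_span hx), mul_zero]

theorem exists_eq_smul_unit {w : H} (hw : w ≠ 0) :
    ∃ g : H, ‖g‖ = 1 ∧ w = (‖w‖ : ℂ) • g ∧ ∀ v, ⟪v, w⟫_ℂ = 0 → ⟪v, g⟫_ℂ = 0 := by
  have h : (‖w‖ : ℂ) ≠ 0 := by exact_mod_cast norm_ne_zero_iff.2 hw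
  refine ⟨((‖w‖ : ℂ)⁻¹) • w, ?_, ?_, fun v hv => ?_⟩
  · rw [norm_smul, norm_inv, Complex.norm_real, norm_norm, inv_mul_cancel₀ (norm_ne_zero_iff.2 hw)]
  · rw [smul_smul, mul_inv_cancel₀ h, one_smul]
  · rw [inner_smul_right, hv, mul_zero]

theorem coeff_smul (Φ : TraceClass H →L[ℂ] (HilbertTensor H →L[ℂ] HilbertTensor H))
    (p q r s t : ℂ) (x u v w z : H) :
    coeff Φ (p • x) (q • u) (r • v) (s • w) (t • z) =
      (star p * p * star q * star r * s * t) * coeff Φ x u v w z := by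
  simp only [coeff, TraceClass.rankOne_smul_left, TraceClass.rankOne_smul_right, tens_smul_left,
    tens_smul_right, map_smul, smul_apply, inner_smul_left, inner_smul_right, starRingEnd_apply]
  ring

/-- A matrix coefficient between eigenvectors of a unitary with different eigenvalues vanishes. -/
theorem IsCovariant.coeff_eq_zero (hΦ : IsCovariant Φ) (U : unitary (H →L[ℂ] H))
    {p q r s t : ℂ} {x u v w z : H} (hx : (U : H →L[ℂ] H) x = p • x)
    (hu : (U : H →L[ℂ] H) u = q • u) (hv : (U : H →L[ℂ] H) v = r • v)
    (hw : (U : H →L[ℂ] H) w = s • w) (hz : (U : H →L[ℂ] H) z = t • z)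
    (h : star p * p * star q * star r * s * t ≠ 1) : coeff Φ x u v w z = 0 := by
  have h1 := hΦ.coeff_map U x u v w z
  rw [hx, hu, hv, hw, hz, coeff_smul] at h1
  have h2 : (star p * p * star q * star r * s * t - 1) * coeff Φ x u v w z = 0 := by
    linear_combination h1
  exact (mul_eq_zero.1 h2).resolve_left (sub_ne_zero.2 h)

/-- A complex number of modulus one that is not a root of unity. -/
def phase : ℂ := ⟨3 / 5, 4 / 5⟩

theorem exists_unitary_phase {e f : H} (he : ‖e‖ = 1) (hf : ‖f‖ = 1) (hef : ⟪e, f⟫_ℂ = 0) :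
    ∃ U : unitary (H →L[ℂ] H), (U : H →L[ℂ] H) e = phase • e ∧
      (U : H →L[ℂ] H) f = star phase • f ∧
      ∀ v, ⟪e, v⟫_ℂ = 0 → ⟪f, v⟫_ℂ = 0 → (U : H →L[ℂ] H) v = (1 : ℂ) • v := by
  have h1 : star phase * phase = 1 := by
    simp [phase, Complex.ext_iff]; norm_num
  have h2 : star (star phase) * star phase = 1 := by
    rw [star_star, mul_comm, h1]
  obtain ⟨U, hU⟩ := exists_unitary_complexReflection he h1
  obtain ⟨V, hV⟩ := exists_unitary_complexReflection hf h2
  have hee := inner_self_of_norm_eq_one he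
  have hff := inner_self_of_norm_eq_one hf
  have hfe := inner_eq_zero_symm.1 hef
  refine ⟨U * V, ?_, ?_, fun v hev hfv => ?_⟩
  · simp only [Submonoid.coe_mul, mul_apply_eq_comp, hV, hfe, hU, hee, mul_zero, zero_smul,
      add_zero, mul_one, sub_smul, one_smul, add_sub_cancel]
  · simp only [Submonoid.coe_mul, mul_apply_eq_comp, hV, hU, hef, hff, mul_zero, zero_smul,
      add_zero, mul_one, sub_smul, one_smul, add_sub_cancel, inner_smul_right]
  · simp only [Submonoid.coe_mul, mul_apply_eq_comp, hV, hfv, hU, hev, mul_zero, zero_smul,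
      add_zero, one_smul]

/-- The rotation `e ↦ (e + f)/√2`, `f ↦ (e - f)/√2` fixes the projection onto the plane of `e` and
`f` and sends `e ⊗ f + f ⊗ e` to `e ⊗ e - f ⊗ f`. Equating the two quadratic forms expresses the
coefficient at `e ⊗ e` through the others. This is why six, and not seven, parameters remain. -/
theorem IsCovariant.coeff_self_eq_zero (hΦ : IsCovariant Φ)
    (h : ∀ e f : H, ‖e‖ = 1 → ‖f‖ = 1 → ⟪e, f⟫_ℂ = 0 →
      coeff Φ e e f e f = 0 ∧ coeff Φ e f e f e = 0 ∧ coeff Φ e e f f e = 0 ∧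
      coeff Φ e f e e f = 0 ∧ coeff Φ e f f f f = 0)
    {e f : H} (he : ‖e‖ = 1) (hf : ‖f‖ = 1) (hef : ⟪e, f⟫_ℂ = 0) : coeff Φ e e e e e = 0 := by
  obtain ⟨a, b, c, d, k⟩ := h e f he hf hef
  have hfe := inner_eq_zero_symm.1 hef
  obtain ⟨a', b', c', d', k'⟩ := h f e hf he hfe
  have hee := inner_self_of_norm_eq_one he
  have hff := inner_self_of_norm_eq_one hf
  obtain ⟨W, hWe, hWf, -⟩ := exists_unitary_map_pair_eq he hf hef hf he hfe
  have hγ : coeff Φ f f f f f = coeff Φ e e e e e := by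
    rw [← hΦ.coeff_map W e e e e e, hWe]
  obtain ⟨P, hPe, hPf, -⟩ := exists_unitary_phase he hf hef
  -- The cross terms between `e ⊗ e` and `f ⊗ f` carry the weight `phase ^ (±4) ≠ 1`.
  have z1 : coeff Φ e e e f f = 0 := hΦ.coeff_eq_zero P hPe hPe hPe hPf hPf (by
    simp [phase, Complex.ext_iff]; norm_num)
  have z2 : coeff Φ e f f e e = 0 := hΦ.coeff_eq_zero P hPe hPf hPf hPe hPe (by
    simp [phase, Complex.ext_iff]; norm_num)
  have z3 : coeff Φ f e e f f = 0 := hΦ.coeff_eq_zero P hPf hPe hPe hPf hPf (by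
    simp [phase, Complex.ext_iff]; norm_num)
  have z4 : coeff Φ f f f e e = 0 := hΦ.coeff_eq_zero P hPf hPf hPf hPe hPe (by
    simp [phase, Complex.ext_iff]; norm_num)
  set r : ℂ := (((√2)⁻¹ : ℝ) : ℂ) with hr
  have hrr : r * r = 1 / 2 := by
    rw [hr, ← Complex.ofReal_mul, ← mul_inv, Real.mul_self_sqrt (by norm_num)]
    norm_num
  have hrs : (starRingEnd ℂ) r = r := Complex.conj_ofReal _
  have hrs' : star r = r := hrs
  have unit_of : ∀ v : H, ⟪v, v⟫_ℂ = 1 → ‖v‖ = 1 := fun v hv => by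
    rw [norm_eq_sqrt_re_inner (𝕜 := ℂ), hv]
    simp
  obtain ⟨U, hUe, hUf, -⟩ := exists_unitary_map_pair_eq (x' := r • (e + f)) (y' := r • (e - f))
    he hf hef
    (unit_of _ (by
      simp only [inner_smul_left, inner_smul_right, inner_add_left, inner_add_right, hee, hff, hef,
        hfe, hrs]
      linear_combination 2 * hrr))
    (unit_of _ (by
      simp only [inner_smul_left, inner_smul_right, inner_sub_left, inner_sub_right, hee, hff, hef,
        hfe, hrs]
      linear_combination 2 * hrr))
    (by
      simp only [inner_smul_left, inner_smul_right, inner_add_left, inner_sub_right, hee, hff, hef,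
        hfe, hrs]
      ring)
  have key := hΦ.inner_conj U (TraceClass.rankOne e e + TraceClass.rankOne f f)
    (tens e f + tens f e) (tens e f + tens f e)
  have hP : TraceClass.conj U (TraceClass.rankOne e e + TraceClass.rankOne f f) =
      TraceClass.rankOne e e + TraceClass.rankOne f f := by
    have : TraceClass.conj U (TraceClass.rankOne e e + TraceClass.rankOne f f) =
        TraceClass.conj U (TraceClass.rankOne e e) + TraceClass.conj U (TraceClass.rankOne f f) :=
      TraceClass.ext (by simp [mul_add, add_mul])
    rw [this, TraceClass.conj_rankOne, TraceClass.conj_rankOne, hUe, hUf, sub_eq_add_neg,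
      ← neg_one_smul ℂ f]
    simp only [TraceClass.rankOne_smul_left, TraceClass.rankOne_smul_right,
      TraceClass.rankOne_add_left, TraceClass.rankOne_add_right, hrs', star_neg, star_one]
    match_scalars <;> first | ring1 | linear_combination 2 * hrr
  have hs : tensorOp (U : H →L[ℂ] H) (U : H →L[ℂ] H) (tens e f + tens f e) =
      tens e e - tens f f := by
    rw [map_add, tensorOp_tens, tensorOp_tens, hUe, hUf, sub_eq_add_neg, ← neg_one_smul ℂ f]
    simp only [tens_smul_left, tens_smul_right, tens_add_left, tens_add_right]
    match_scalars <;> first | ring1 | linear_combination 2 * hrr | linear_combination -2 * hrr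
  rw [hP, hs] at key
  simp only [coeff] at *
  simp only [map_add, map_sub, add_apply, inner_sub_left, inner_sub_right, inner_add_left,
    inner_add_right, a, b, c, d, k, a', b', c', d', k', hγ, z1, z2, z3, z4] at key
  linear_combination key / 2

/-- A covariant map vanishes if its independent matrix coefficients do. -/
theorem IsCovariant.eq_zero (hΦ : IsCovariant Φ) (hdim : 2 ≤ Module.rank ℂ H)
    (h : ∀ e f : H, ‖e‖ = 1 → ‖f‖ = 1 → ⟪e, f⟫_ℂ = 0 →
      coeff Φ e e f e f = 0 ∧ coeff Φ e f e f e = 0 ∧ coeff Φ e e f f e = 0 ∧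
      coeff Φ e f e e f = 0 ∧ coeff Φ e f f f f = 0)
    (h' : ∀ e f g : H, ‖e‖ = 1 → ‖f‖ = 1 → ‖g‖ = 1 → ⟪e, f⟫_ℂ = 0 → ⟪e, g⟫_ℂ = 0 →
      ⟪f, g⟫_ℂ = 0 → coeff Φ e f g f g = 0) : Φ = 0 := by
  have hunit : ∀ e : H, ‖e‖ = 1 → Φ (TraceClass.rankOne e e) = 0 := fun e he => by
    refine eq_zero_of_inner_tens_self fun y z => ?_
    have hee := inner_self_of_norm_eq_one he
    -- A unit `f ⊥ e` is adapted to `y`; when `y` is a multiple of `e`, any such `f` will do, with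
    -- `α = 0`.
    obtain ⟨f, α, hf, hef, hy⟩ : ∃ (f : H) (α : ℂ), ‖f‖ = 1 ∧ ⟪e, f⟫_ℂ = 0 ∧
        y = ⟪e, y⟫_ℂ • e + α • f := by
      have h0 : ⟪e, y - ⟪e, y⟫_ℂ • e⟫_ℂ = 0 := by
        rw [inner_sub_right, inner_smul_right, hee, mul_one, sub_self]
      by_cases hy : y - ⟪e, y⟫_ℂ • e = 0
      · obtain ⟨f, hf, hef⟩ := exists_norm_eq_one_inner_eq_zero {e}
          (lt_of_lt_of_le (by simp) hdim)
        exact ⟨f, 0, hf, hef e (by simp), by rw [zero_smul, add_zero, ← sub_eq_zero, hy]⟩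
      · obtain ⟨f, hf, hyf, ho⟩ := exists_eq_smul_unit hy
        exact ⟨f, _, hf, ho e h0, by rw [← hyf]; abel⟩
    have hff := inner_self_of_norm_eq_one hf
    have hfe := inner_eq_zero_symm.1 hef
    set w := z - ⟪e, z⟫_ℂ • e - ⟪f, z⟫_ℂ • f with hw
    have hew : ⟪e, w⟫_ℂ = 0 := by
      rw [hw, inner_sub_right, inner_sub_right, inner_smul_right, inner_smul_right, hee, hef]
      ring
    have hfw : ⟪f, w⟫_ℂ = 0 := by
      rw [hw, inner_sub_right, inner_sub_right, inner_smul_right, inner_smul_right, hff, hfe]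
      ring
    have hz : z = ⟪e, z⟫_ℂ • e + ⟪f, z⟫_ℂ • f + w := by rw [hw]; abel
    obtain ⟨a, b, c, d, k⟩ := h e f he hf hef
    have hγ := hΦ.coeff_self_eq_zero h he hf hef
    -- The vector `w` is not normalized and may vanish, in particular always in dimension two, where
    -- `h'` is vacuous.
    have haw : coeff Φ e e w e w = 0 ∧ coeff Φ e f w f w = 0 := by
      by_cases hw0 : w = 0
      · simp [coeff, hw0, tens, UniformSpace.Completion.coe_zero]
      · obtain ⟨g, hg, hwg, ho⟩ := exists_eq_smul_unit hw0
        have eg := (h e g he hg (ho e hew)).1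
        have fg := h' e f g he hf hg hef (ho e hew) (ho f hfw)
        have hc1 := coeff_smul Φ 1 1 (‖w‖ : ℂ) 1 (‖w‖ : ℂ) e e g e g
        have hc2 := coeff_smul Φ 1 1 (‖w‖ : ℂ) 1 (‖w‖ : ℂ) e f g f g
        rw [← hwg, eg, mul_zero] at hc1
        rw [← hwg, fg, mul_zero] at hc2
        simp only [one_smul] at hc1 hc2
        exact ⟨hc1, hc2⟩
    obtain ⟨P, hPe, hPf, hPv⟩ := exists_unitary_phase he hf hef
    have hPw := hPv w hew hfw
    let t₁ : Fin 6 → H := ![e, e, e, f, f, f]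
    let t₂ : Fin 6 → H := ![e, f, w, e, f, w]
    let χ₁ : Fin 6 → ℂ := ![phase, phase, phase, star phase, star phase, star phase]
    let χ₂ : Fin 6 → ℂ := ![phase, star phase, 1, phase, star phase, 1]
    have ht₁ : ∀ i, (P : H →L[ℂ] H) (t₁ i) = χ₁ i • t₁ i := fun i => by
      fin_cases i <;> assumption
    have ht₂ : ∀ i, (P : H →L[ℂ] H) (t₂ i) = χ₂ i • t₂ i := fun i => by
      fin_cases i <;> assumption
    have hall : ∀ i j, coeff Φ e (t₁ i) (t₂ i) (t₁ j) (t₂ j) = 0 := fun i j => by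
      by_cases hχ : star phase * phase * star (χ₁ i) * star (χ₂ i) * χ₁ j * χ₂ j = 1
      -- The six tensors `ee, ef, ew, fe, ff, fw` have weights `phase ^ 2, 1, phase, 1, phase ^
      -- (-2), phase ^ (-1)`; only `ef` and `fe` coincide.
      · have hij : i = j ∨ (i = 1 ∧ j = 3) ∨ (i = 3 ∧ j = 1) := by
          revert hχ
          fin_cases i <;> fin_cases j <;>
            simp [χ₁, χ₂, phase, Complex.ext_iff] <;> norm_num
        rcases hij with rfl | ⟨rfl, rfl⟩ | ⟨rfl, rfl⟩
        · fin_cases i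
          exacts [hγ, a, haw.1, b, k, haw.2]
        · exact c
        · exact d
      · exact hΦ.coeff_eq_zero P hPe (ht₁ i) (ht₂ i) (ht₁ j) (ht₂ j) hχ
    have hsum : tens y z = ∑ i, (![⟪e, y⟫_ℂ * ⟪e, z⟫_ℂ, ⟪e, y⟫_ℂ * ⟪f, z⟫_ℂ, ⟪e, y⟫_ℂ, α * ⟪e, z⟫_ℂ,
        α * ⟪f, z⟫_ℂ, α] : Fin 6 → ℂ) i • tens (t₁ i) (t₂ i) := by
      conv_lhs => rw [hy, hz]
      simp only [Fin.sum_univ_six, tens_add_left, tens_add_right, tens_smul_left, tens_smul_right,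
        smul_add, smul_smul]
      simp [t₁, t₂]
      module
    rw [hsum, map_sum, sum_inner]
    refine Finset.sum_eq_zero fun i _ => ?_
    rw [inner_sum]
    refine Finset.sum_eq_zero fun j _ => ?_
    rw [map_smul, inner_smul_left, inner_smul_right]
    have := hall i j
    rw [coeff] at this
    rw [this, mul_zero, mul_zero]
  ext1 X
  refine TraceClass.mem_of_rankOne_mem (LinearMap.ker
    (Φ : TraceClass H →ₗ[ℂ] (HilbertTensor H →L[ℂ] HilbertTensor H)))
    Φ.isClosed_ker (fun x => ?_) X
  show Φ (TraceClass.rankOne x x) = 0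
  by_cases hx : x = 0
  · have : TraceClass.rankOne x x = 0 := TraceClass.ext (by simp [hx])
    rw [this, map_zero]
  · obtain ⟨e, he, hxe, -⟩ := exists_eq_smul_unit hx
    rw [hxe, TraceClass.rankOne_smul_left, TraceClass.rankOne_smul_right, map_smul, map_smul,
      hunit e he, smul_zero, smul_zero]

/-- Every covariant map is a six-term map. -/
theorem IsCovariant.exists_eq_sixTerm (hΦ : IsCovariant Φ) (hdim : 2 ≤ Module.rank ℂ H) :
    ∃ m₁ m₂ m₃ m₄ m₅ m₆ : ℂ, Φ = sixTerm H m₁ m₂ m₃ m₄ m₅ m₆ := by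
  obtain ⟨e₀, he₀, -⟩ := exists_norm_eq_one_inner_eq_zero (H := H) ∅
    (lt_of_lt_of_le (by simp) hdim)
  obtain ⟨f₀, hf₀, hef₀⟩ := exists_norm_eq_one_inner_eq_zero {e₀} (lt_of_lt_of_le (by simp) hdim)
  replace hef₀ := hef₀ e₀ (by simp)
  obtain ⟨β, hβ⟩ : ∃ β : ℂ, ∀ e f g : H, ‖e‖ = 1 → ‖f‖ = 1 → ‖g‖ = 1 → ⟪e, f⟫_ℂ = 0 →
      ⟪e, g⟫_ℂ = 0 → ⟪f, g⟫_ℂ = 0 → coeff Φ e f g f g = β := by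
    by_cases hg : ∃ e f g : H, ‖e‖ = 1 ∧ ‖f‖ = 1 ∧ ‖g‖ = 1 ∧ ⟪e, f⟫_ℂ = 0 ∧
      ⟪e, g⟫_ℂ = 0 ∧ ⟪f, g⟫_ℂ = 0
    · obtain ⟨e₁, f₁, g₁, he₁, hf₁, hg₁, hef₁, heg₁, hfg₁⟩ := hg
      refine ⟨coeff Φ e₁ f₁ g₁ f₁ g₁, fun e f g he hf hg hef heg hfg => ?_⟩
      obtain ⟨U, hUe, hUf, -⟩ := exists_unitary_map_pair_eq he₁ hf₁ hef₁ he hf hef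
      -- `U g₁` and `g` are both orthogonal to `e` and `f`, so the correcting reflection keeps `e`
      -- and `f` in place.
      obtain ⟨V, hV, hVf⟩ := exists_unitary_map_eq (x := (U : H →L[ℂ] H) g₁) (y := g)
        (by rw [norm_unitary_apply, hg₁]) hg
      have hVe : (V : H →L[ℂ] H) e = e := hVf e (by
        rw [inner_sub_left, ← hUe, inner_unitary_apply, inner_eq_zero_symm.1 heg₁, hUe,
          inner_eq_zero_symm.1 heg, sub_zero])
      have hVf : (V : H →L[ℂ] H) f = f := hVf f (by
        rw [inner_sub_left, ← hUf, inner_unitary_apply, inner_eq_zero_symm.1 hfg₁, hUf,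
          inner_eq_zero_symm.1 hfg, sub_zero])
      have h := hΦ.coeff_map V e f ((U : H →L[ℂ] H) g₁) f ((U : H →L[ℂ] H) g₁)
      rw [hVe, hVf, hV] at h
      rw [h, ← hΦ.coeff_map U e₁, hUe, hUf]
    -- Without orthonormal triples the value is free; this reflects the non-uniqueness of the
    -- coefficients in dimension two.
    · exact ⟨0, fun e f g he hf hg' hef heg hfg =>
        absurd ⟨e, f, g, he, hf, hg', hef, heg, hfg⟩ hg⟩
  set a := coeff Φ e₀ e₀ f₀ e₀ f₀
  set b := coeff Φ e₀ f₀ e₀ f₀ e₀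
  set c := coeff Φ e₀ e₀ f₀ f₀ e₀
  set d := coeff Φ e₀ f₀ e₀ e₀ f₀
  set k := coeff Φ e₀ f₀ f₀ f₀ f₀
  -- By `coeff_sixTerm` the measured values are `b = m₁ + m₅`, `a = m₂ + m₅`, `c = m₃ + m₆`, `d = m₄
  -- + m₆`, `k = m₅ + m₆` and, on triples, `β = m₅`.
  refine ⟨b - β, a - β, c - (k - β), d - (k - β), β, k - β, sub_eq_zero.1 ?_⟩
  have hsub : ∀ Ψ : TraceClass H →L[ℂ] (HilbertTensor H →L[ℂ] HilbertTensor H), ∀ x u v w z : H,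
      coeff (Φ - Ψ) x u v w z = coeff Φ x u v w z - coeff Ψ x u v w z := fun Ψ x u v w z => by
    simp [coeff, inner_sub_right]
  refine (hΦ.sub (isCovariant_sixTerm _ _ _ _ _ _)).eq_zero hdim (fun e f he hf hef => ?_)
    fun e f g he hf hg hef heg hfg => ?_
  · have hee := inner_self_of_norm_eq_one he
    have hff := inner_self_of_norm_eq_one hf
    have hfe := inner_eq_zero_symm.1 hef
    obtain ⟨U, hUe, hUf, -⟩ := exists_unitary_map_pair_eq he₀ hf₀ hef₀ he hf hef
    have ha : coeff Φ e e f e f = a := by rw [← hUe, ← hUf, hΦ.coeff_map]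
    have hb : coeff Φ e f e f e = b := by rw [← hUe, ← hUf, hΦ.coeff_map]
    have hc : coeff Φ e e f f e = c := by rw [← hUe, ← hUf, hΦ.coeff_map]
    have hd : coeff Φ e f e e f = d := by rw [← hUe, ← hUf, hΦ.coeff_map]
    have hk : coeff Φ e f f f f = k := by rw [← hUe, ← hUf, hΦ.coeff_map]
    simp only [hsub, coeff_sixTerm, hee, hff, hef, hfe, ha, hb, hc, hd, hk]
    refine ⟨?_, ?_, ?_, ?_, ?_⟩ <;> ring
  · have hee := inner_self_of_norm_eq_one he
    have hff := inner_self_of_norm_eq_one hf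
    have hgg := inner_self_of_norm_eq_one hg
    simp only [hsub, coeff_sixTerm, hee, hff, hgg, hef, hfg, heg, inner_eq_zero_symm.1 hef,
      inner_eq_zero_symm.1 heg, inner_eq_zero_symm.1 hfg, hβ e f g he hf hg hef heg hfg]
    ring

/-! ## Hermitian-preserving maps -/

theorem TraceClass.trace_star (X : TraceClass H) : (star X).trace = star X.trace := by
  refine (TraceClass.hasSum_trace (stdBasis H) (star X)).unique ?_
  have h := (TraceClass.hasSum_trace (stdBasis H) X).star
  convert h using 2 with i
  rw [TraceClass.toOp_star, ContinuousLinearMap.star_eq_adjoint,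
    ContinuousLinearMap.adjoint_inner_right, ← inner_conj_symm, starRingEnd_apply]

/-- The third and fourth coefficients trade places because `(S (I ⊗ X))* = (I ⊗ X*) S = S (X* ⊗ I)`.
-/
theorem star_sixTerm (m₁ m₂ m₃ m₄ m₅ m₆ : ℂ) (X : TraceClass H) :
    star (sixTerm H m₁ m₂ m₃ m₄ m₅ m₆ (star X)) =
      sixTerm H (star m₁) (star m₂) (star m₄) (star m₃) (star m₅) (star m₆) X := by
  have h1 : tensorOp 1 X.toOp * swap H = swap H * tensorOp X.toOp 1 := (swap_mul_tensorOp _ _).symm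
  have h2 : tensorOp X.toOp 1 * swap H = swap H * tensorOp 1 X.toOp := (swap_mul_tensorOp _ _).symm
  simp only [sixTerm_apply, star_op_add, star_op_smul, star_op_mul, star_tensorOp, star_swap, star_one,
    TraceClass.toOp_star, star_star, TraceClass.trace_star, h1, h2, star_mul']
  abel

theorem HasHermitianForm.isHermitianPreserving {μ₁ μ₂ : ℝ} {μ₃ μ₄ : ℂ} {μ₅ μ₆ : ℝ}
    (h : HasHermitianForm Φ μ₁ μ₂ μ₃ μ₄ μ₅ μ₆) : IsHermitianPreserving Φ := fun X => by
  obtain ⟨h34, rfl⟩ := hasHermitianForm_iff.1 h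
  have hr : ∀ r : ℝ, star (r : ℂ) = r := Complex.conj_ofReal
  have hs := star_sixTerm (μ₁ : ℂ) μ₂ μ₃ μ₄ μ₅ μ₆ X
  rw [hr, hr, hr, hr, ← h34, h34, star_star, ← h34] at hs
  rw [← hs, star_op_star]

/-- `Φ` is the average of its two representations, and averaging makes the coefficients real or
mutually conjugate. Linear independence of the six terms, which fails in dimension two, is not
needed. -/
theorem exists_hasHermitianForm_of_star {m₁ m₂ m₃ m₄ m₅ m₆ : ℂ}
    (hΦ : Φ = sixTerm H m₁ m₂ m₃ m₄ m₅ m₆)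
    (hΦ' : Φ = sixTerm H (star m₁) (star m₂) (star m₄) (star m₃) (star m₅) (star m₆)) :
    ∃ (μ₁ μ₂ : ℝ) (μ₃ μ₄ : ℂ) (μ₅ μ₆ : ℝ), HasHermitianForm Φ μ₁ μ₂ μ₃ μ₄ μ₅ μ₆ := by
  refine ⟨m₁.re, m₂.re, (m₃ + star m₄) / 2, (m₄ + star m₃) / 2, m₅.re, m₆.re,
    hasHermitianForm_iff.2 ⟨?_, ?_⟩⟩
  · rw [star_div₀, star_add, star_star, add_comm]
    simp
  · have hre : ∀ z : ℂ, (z.re : ℂ) = (1 / 2 : ℂ) * (z + star z) := fun z => by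
      rw [Complex.re_eq_add_conj, starRingEnd_apply]
      ring
    have h2 : Φ = (1 / 2 : ℂ) • (Φ + Φ) := by
      rw [← two_smul ℂ Φ, smul_smul]
      norm_num
    rw [h2]
    conv_lhs => enter [2, 1]; rw [hΦ]
    conv_lhs => enter [2, 2]; rw [hΦ']
    ext1 X
    simp only [smul_apply, add_apply, sixTerm_apply, hre]
    module

theorem IsHermitianPreserving.exists_hasHermitianForm (h : IsHermitianPreserving Φ)
    (hΦ : IsCovariant Φ) (hdim : 2 ≤ Module.rank ℂ H) :
    ∃ (μ₁ μ₂ : ℝ) (μ₃ μ₄ : ℂ) (μ₅ μ₆ : ℝ), HasHermitianForm Φ μ₁ μ₂ μ₃ μ₄ μ₅ μ₆ := by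
  obtain ⟨m₁, m₂, m₃, m₄, m₅, m₆, hm⟩ := hΦ.exists_eq_sixTerm hdim
  refine exists_hasHermitianForm_of_star hm ?_
  ext1 X
  rw [← star_sixTerm, ← hm, h, star_op_star]

/-- Positive operators are self-adjoint, so `Φ(|x⟩⟨x|)` equals its own adjoint; totality of the
`|x⟩⟨x|` extends the equality of the two six-term representations to all `X`. -/
theorem IsPositiveMap.exists_hasHermitianForm (h : IsPositiveMap Φ)
    (hΦ : IsCovariant Φ) (hdim : 2 ≤ Module.rank ℂ H) :
    ∃ (μ₁ μ₂ : ℝ) (μ₃ μ₄ : ℂ) (μ₅ μ₆ : ℝ), HasHermitianForm Φ μ₁ μ₂ μ₃ μ₄ μ₅ μ₆ := by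
  obtain ⟨m₁, m₂, m₃, m₄, m₅, m₆, hm⟩ := hΦ.exists_eq_sixTerm hdim
  refine exists_hasHermitianForm_of_star hm (sub_eq_zero.1 ?_)
  set Ψ := Φ - sixTerm H (star m₁) (star m₂) (star m₄) (star m₃) (star m₅) (star m₆) with hΨ
  ext1 X
  refine TraceClass.mem_of_rankOne_mem (LinearMap.ker
    (Ψ : TraceClass H →ₗ[ℂ] (HilbertTensor H →L[ℂ] HilbertTensor H))) Ψ.isClosed_ker
    (fun x => ?_) X
  show Ψ (TraceClass.rankOne x x) = 0
  have hpos := h (TraceClass.rankOne x x) (InnerProductSpace.isPositive_rankOne_self x)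
  rw [hΨ, sub_apply, ← star_sixTerm, ← hm, TraceClass.star_rankOne, hpos.isSelfAdjoint.star_eq,
    sub_self]

/-! ## Positive maps -/

theorem isPositive_of_inner_nonneg {E : Type*} [NormedAddCommGroup E] [InnerProductSpace ℂ E]
    {T : E →L[ℂ] E} (h : ∀ ξ, 0 ≤ ⟪ξ, T ξ⟫_ℂ) : T.IsPositive := by
  refine (ContinuousLinearMap.isPositive_toLinearMap_iff T).1
    ((LinearMap.isPositive_iff_complex _).2 fun ξ => ?_)
  have h1 : ⟪(T : E →ₗ[ℂ] E) ξ, ξ⟫_ℂ = ⟪ξ, T ξ⟫_ℂ := by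
    rw [← inner_conj_symm]
    exact Complex.conj_eq_iff_im.2 (Complex.nonneg_iff.1 (h ξ)).2.symm
  rw [h1]
  exact ⟨Complex.ext (by simp) (by simpa using (Complex.nonneg_iff.1 (h ξ)).2),
    (Complex.nonneg_iff.1 (h ξ)).1⟩

/-- It suffices to check positivity of a map on the projections `|e⟩⟨e|`. -/
theorem isPositiveMap_of_rankOne
    (h : ∀ e : H, ‖e‖ = 1 → (Φ (TraceClass.rankOne e e)).IsPositive) : IsPositiveMap Φ := by
  have h' : ∀ x : H, (Φ (TraceClass.rankOne x x)).IsPositive := fun x => by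
    by_cases hx : x = 0
    · have : TraceClass.rankOne x x = 0 := TraceClass.ext (by simp [hx])
      rw [this, map_zero]
      exact ContinuousLinearMap.isPositive_zero
    · obtain ⟨e, he, hxe, -⟩ := exists_eq_smul_unit hx
      rw [hxe, TraceClass.rankOne_smul_left, TraceClass.rankOne_smul_right, smul_smul, map_smul]
      refine (h e he).smul_of_nonneg ?_
      rw [mul_comm]
      exact star_mul_self_nonneg _
  refine fun X hX => isPositive_of_inner_nonneg fun ξ => ?_
  -- With `R = X^(1/2)`, `X` is the trace-norm sum of the `|R bᵢ⟩⟨R bᵢ|`, so continuity of `Φ` makes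
  -- `⟨ξ, Φ(X) ξ⟩` a convergent sum of nonnegative terms.
  have hs := (TraceClass.hasSum_rankOne_of_isPositive X hX).mapL Φ
  have hs2 := hs.mapL (ContinuousLinearMap.apply ℂ (HilbertTensor H) ξ)
  have hs3 := hs2.mapL (innerSL ℂ ξ)
  exact hs3.nonneg fun i => (h' _).inner_nonneg_right ξ

/-! ### Sufficiency of the coefficient conditions. -/

theorem eq_zero_of_inner_eq_zero_of_rank_lt {e f v : H} (he : ‖e‖ = 1) (hf : ‖f‖ = 1)
    (hef : ⟪e, f⟫_ℂ = 0) (hrank : Module.rank ℂ H < 3) (hev : ⟪e, v⟫_ℂ = 0)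
    (hfv : ⟪f, v⟫_ℂ = 0) : v = 0 := by
  by_contra hv
  obtain ⟨g, hg, -, ho⟩ := exists_eq_smul_unit hv
  have hon : Orthonormal ℂ ![e, f, g] := by
    rw [orthonormal_iff_ite]
    intro i j
    fin_cases i <;> fin_cases j <;>
      simp [he, hf, hg, hef, ho e hev, ho f hfv, inner_eq_zero_symm.1 hef,
        inner_eq_zero_symm.1 (ho e hev), inner_eq_zero_symm.1 (ho f hfv)]
  have := hon.linearIndependent.cardinal_lift_le_rank
  simp only [Cardinal.mk_fin, Cardinal.lift_natCast, Cardinal.lift_id'] at this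
  exact absurd hrank (not_lt.2 (by exact_mod_cast this))

theorem isPositive_smul_of_nonneg_or {E : Type*} [NormedAddCommGroup E] [InnerProductSpace ℂ E]
    [CompleteSpace E] {c : ℝ} {T : E →L[ℂ] E} (h : 0 ≤ c ∨ T = 0) :
    ((c : ℂ) • (star T * T)).IsPositive := by
  rcases h with h | rfl
  · exact (ContinuousLinearMap.isPositive_adjoint_comp_self T).smul_of_nonneg
      (Complex.zero_le_real.2 h)
  · simp

open scoped MatrixOrder Matrix.Norms.L2Operator in
theorem exists_eq_star_mul_self_of_posSemidef {M : Matrix (Fin 2) (Fin 2) ℂ}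
    (hM : M.PosSemidef) : ∃ R : Matrix (Fin 2) (Fin 2) ℂ, M = star R * R :=
  CStarAlgebra.nonneg_iff_eq_star_mul_self.mp hM.nonneg

theorem rank_eq_two_of_not_le (hdim : 2 ≤ Module.rank ℂ H) (h : ¬3 ≤ Module.rank ℂ H) :
    Module.rank ℂ H = 2 := by
  have h3 : Module.rank ℂ H < (3 : ℕ) := by simpa using h
  obtain ⟨n, hn⟩ := Cardinal.lt_aleph0.1 (h3.trans (Cardinal.natCast_lt_aleph0))
  rw [hn] at hdim h3 ⊢
  norm_cast at hdim h3 ⊢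
  omega

/-- The block decomposition along `e ⊗ e`, `e^⊥ ⊗ e + e ⊗ e^⊥` and `e^⊥ ⊗ e^⊥` is written as one
identity, `key`, expressing the operator as a combination of terms `star C * C`; positivity is then
read off from the scalars. -/
theorem isPositive_sixTerm_rankOne {μ₁ μ₂ : ℝ} {μ₃ μ₄ : ℂ} {μ₅ μ₆ : ℝ} (h34 : μ₃ = star μ₄)
    (h : PositivityConditions H μ₁ μ₂ μ₃ μ₄ μ₅ μ₆) (hdim : 2 ≤ Module.rank ℂ H) {e : H}
    (he : ‖e‖ = 1) :
    (sixTerm H μ₁ μ₂ μ₃ μ₄ μ₅ μ₆ (TraceClass.rankOne e e)).IsPositive := by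
  obtain ⟨hsum, hM, h3, h2⟩ := h
  obtain ⟨R, hR⟩ := exists_eq_star_mul_self_of_posSemidef hM
  have hR00 := congrFun (congrFun hR 0) 0
  have hR01 := congrFun (congrFun hR 0) 1
  have hR10 := congrFun (congrFun hR 1) 0
  have hR11 := congrFun (congrFun hR 1) 1
  simp only [Matrix.star_eq_conjTranspose, Matrix.mul_apply, Matrix.conjTranspose_apply, Fin.sum_univ_two, Matrix.of_apply,
    Matrix.cons_val_zero, Matrix.cons_val_one, Matrix.cons_val', Matrix.cons_val_fin_one]
    at hR00 hR01 hR10 hR11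
  have hR01' : μ₄ + μ₆ = star (R 0 0) * R 0 1 + star (R 1 0) * R 1 1 := by
    rw [← hR01, h34, star_star]
  have hee := inner_self_of_norm_eq_one he
  set p : H →L[ℂ] H := InnerProductSpace.rankOne ℂ e e with hp
  set q : H →L[ℂ] H := 1 - p with hq
  have hps : star p = p := by
    rw [hp, ContinuousLinearMap.star_eq_adjoint, InnerProductSpace.adjoint_rankOne]
  have hqs : star q = q := by rw [hq, star_sub, hps, star_one]
  have hpe : p e = e := by simp [hp, he]
  have hqe : q e = 0 := by simp [hq, hpe]
  have hpo : ∀ v, ⟪e, v⟫_ℂ = 0 → p v = 0 := fun v hv => by simp [hp, hv]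
  have hqo : ∀ v, ⟪e, v⟫_ℂ = 0 → q v = v := fun v hv => by simp [hq, hpo v hv]
  have hdec : ∀ v : H, ∃ (c : ℂ) (v' : H), ⟪e, v'⟫_ℂ = 0 ∧ v = c • e + v' := fun v =>
    ⟨⟪e, v⟫_ℂ, v - ⟪e, v⟫_ℂ • e, by rw [inner_sub_right, inner_smul_right, hee]; ring, by abel⟩
  have h0l : ∀ v : H, tens 0 v = 0 := fun v => by simp [tens, UniformSpace.Completion.coe_zero]
  have h0r : ∀ v : H, tens v 0 = 0 := fun v => by simp [tens, UniformSpace.Completion.coe_zero]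
  -- The swap carries `e ⊗ e^⊥` to `e^⊥ ⊗ e`, so the mixed block is the 2×2 matrix `star R * R`
  -- acting on two copies of `e^⊥`; each row of `R` gives one square.
  let T : Fin 2 → HilbertTensor H →L[ℂ] HilbertTensor H := fun k =>
    R k 0 • tensorOp q p + R k 1 • (swap H * tensorOp p q)
  -- Twice the antisymmetric and symmetric parts on `e^⊥ ⊗ e^⊥`. Since `(1 ∓ S)² = 2(1 ∓ S)`, the
  -- weights `(μ₅ ∓ μ₆)/4` add up to `μ₅ + μ₆ S` there.
  let A : HilbertTensor H →L[ℂ] HilbertTensor H := tensorOp q q - swap H * tensorOp q q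
  let B : HilbertTensor H →L[ℂ] HilbertTensor H := tensorOp q q + swap H * tensorOp q q
  have key : sixTerm H μ₁ μ₂ μ₃ μ₄ μ₅ μ₆ (TraceClass.rankOne e e) =
      (μ₁ + μ₂ + μ₃ + μ₄ + μ₅ + μ₆ : ℂ) • (star (tensorOp p p) * tensorOp p p) +
      star (T 0) * T 0 + star (T 1) * T 1 +
      (((μ₅ - μ₆) / 4 : ℝ) : ℂ) • (star A * A) + (((μ₅ + μ₆) / 4 : ℝ) : ℂ) • (star B * B) := by
    refine ext_tens fun x y => ?_
    obtain ⟨a, x', hx', rfl⟩ := hdec x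
    obtain ⟨b, y', hy', rfl⟩ := hdec y
    simp only [T, A, B, sixTerm_apply, TraceClass.trace_rankOne, hee, TraceClass.toOp_rankOne,
      ← hp, star_op_add, star_op_sub, star_op_mul, star_op_smul, star_tensorOp, hps, hqs, star_swap, add_apply,
      sub_apply, smul_apply, mul_apply_eq_comp, map_add, map_sub, map_smul, tens_add_left,
      tens_add_right, tens_smul_left, tens_smul_right, tensorOp_tens, swap_tens, hpe, hqe, hpo x' hx',
      hpo y' hy', hqo x' hx', hqo y' hy', h0l, h0r, one_apply_eq_self, smul_zero, add_zero,
      zero_add, sub_zero, map_zero, mul_one]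
    match_scalars
    all_goals first
      | ring1
      | linear_combination b * hR00
      | linear_combination b * hR10
      | linear_combination a * hR11
      | linear_combination a * hR01'
  have hB : 0 ≤ (μ₅ + μ₆) / 4 := by
    by_cases hr : 3 ≤ Module.rank ℂ H
    · have := neg_le_of_abs_le (h3 hr)
      linarith
    · have := h2 (rank_eq_two_of_not_le hdim hr)
      linarith
  have hA : 0 ≤ (μ₅ - μ₆) / 4 ∨ A = 0 := by
    by_cases hr : 3 ≤ Module.rank ℂ H
    · have := le_of_abs_le (h3 hr)
      exact .inl (by linarith)
    -- In dimension two `e^⊥` is the line through `f`, so `q x ⊗ q y` is a multiple of `f ⊗ f`,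
    -- which the swap fixes.
    · refine .inr (ext_tens fun x y => ?_)
      obtain ⟨f, hf, hef⟩ := exists_norm_eq_one_inner_eq_zero {e} (lt_of_lt_of_le (by simp) hdim)
      replace hef := hef e (by simp)
      have hff := inner_self_of_norm_eq_one hf
      have hqf : ∀ v, q v = ⟪f, q v⟫_ℂ • f := fun v => by
        have hev : ⟪e, q v⟫_ℂ = 0 := by simp [hq, hp, he]
        rw [← sub_eq_zero]
        refine eq_zero_of_inner_eq_zero_of_rank_lt he hf hef (not_le.1 hr) ?_ ?_
        · rw [inner_sub_right, inner_smul_right, hev, hef, mul_zero, sub_zero]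
        · rw [inner_sub_right, inner_smul_right, hff, mul_one, sub_self]
      simp only [A, sub_apply, mul_apply_eq_comp, tensorOp_tens, swap_tens, zero_apply]
      rw [hqf x, hqf y]
      simp only [tens_smul_left, tens_smul_right]
      module
  rw [key]
  have hpos : ∀ C : HilbertTensor H →L[ℂ] HilbertTensor H, (star C * C).IsPositive :=
    ContinuousLinearMap.isPositive_adjoint_comp_self
  exact (((((hpos _).smul_of_nonneg hsum).add (hpos _)).add (hpos _)).add
    (isPositive_smul_of_nonneg_or hA)).add (isPositive_smul_of_nonneg_or (.inl hB))

/-! ### Necessity of the coefficient conditions, by test vectors. -/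

theorem HasHermitianForm.positivityConditions {μ₁ μ₂ : ℝ} {μ₃ μ₄ : ℂ} {μ₅ μ₆ : ℝ}
    (hΦ : HasHermitianForm Φ μ₁ μ₂ μ₃ μ₄ μ₅ μ₆) (h : IsPositiveMap Φ)
    (hdim : 2 ≤ Module.rank ℂ H) : PositivityConditions H μ₁ μ₂ μ₃ μ₄ μ₅ μ₆ := by
  obtain ⟨h34, rfl⟩ := hasHermitianForm_iff.1 hΦ
  obtain ⟨e, he, -⟩ := exists_norm_eq_one_inner_eq_zero (H := H) ∅ (lt_of_lt_of_le (by simp) hdim)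
  obtain ⟨f, hf, hef⟩ := exists_norm_eq_one_inner_eq_zero {e} (lt_of_lt_of_le (by simp) hdim)
  replace hef := hef e (by simp)
  have hfe := inner_eq_zero_symm.1 hef
  have hee := inner_self_of_norm_eq_one he
  have hff := inner_self_of_norm_eq_one hf
  have hpos := (h (TraceClass.rankOne e e)
    (InnerProductSpace.isPositive_rankOne_self e)).inner_nonneg_right
  have hcoeff : ∀ u v w z, ⟪tens u v, sixTerm H μ₁ μ₂ μ₃ μ₄ μ₅ μ₆ (TraceClass.rankOne e e)
      (tens w z)⟫_ℂ = _ := coeff_sixTerm _ _ _ _ _ _ e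
  refine ⟨?_, ?_, fun h3 => ?_, fun _ => ?_⟩
  · have := hpos (tens e e)
    rw [hcoeff, hee] at this
    simpa using this
  · refine Matrix.PosSemidef.of_dotProduct_mulVec_nonneg ?_ fun c => ?_
    · ext i j
      fin_cases i <;> fin_cases j <;> simp
    -- In this order of the two tensors, the quadratic form of `Φ(|e⟩⟨e|)` is the one of the given
    -- matrix.
    · have := hpos (c 0 • tens f e + c 1 • tens e f)
      simp only [map_add, map_smul, inner_add_left, inner_add_right, inner_smul_left,
        inner_smul_right, hcoeff, hee, hef, hfe, hff] at this
      convert this using 1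
      simp [dotProduct, Matrix.mulVec, Fin.sum_univ_two, h34]
      ring
  · classical
    obtain ⟨g, hg, hefg⟩ := exists_norm_eq_one_inner_eq_zero ({e, f} : Finset H)
      (lt_of_lt_of_le (lt_of_le_of_lt (Nat.cast_le.2 Finset.card_le_two) (by norm_num)) h3)
    have heg := hefg e (by simp)
    have hfg := hefg f (by simp)
    have hgg := inner_self_of_norm_eq_one hg
    -- The symmetric and antisymmetric vectors give `2(μ₅ + μ₆) ≥ 0` and `2(μ₅ - μ₆) ≥ 0`.
    have h1 := hpos (tens f g + tens g f)
    have h2 := hpos (tens f g - tens g f)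
    simp only [map_add, map_sub, inner_add_left, inner_add_right, inner_sub_left, inner_sub_right,
      hcoeff, hee, hef, hfe, hff, heg, hfg, hgg, inner_eq_zero_symm.1 heg,
      inner_eq_zero_symm.1 hfg] at h1 h2
    have h1' := (Complex.nonneg_iff.1 h1).1
    have h2' := (Complex.nonneg_iff.1 h2).1
    simp at h1' h2'
    rw [abs_le]
    constructor <;> linarith
  · have := hpos (tens f f)
    rw [hcoeff, hee, hff, hef] at this
    have h' := (Complex.nonneg_iff.1 this).1
    simpa using h'

theorem HasHermitianForm.isPositiveMap_iff {μ₁ μ₂ : ℝ} {μ₃ μ₄ : ℂ} {μ₅ μ₆ : ℝ}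
    (hΦ : HasHermitianForm Φ μ₁ μ₂ μ₃ μ₄ μ₅ μ₆) (hdim : 2 ≤ Module.rank ℂ H) :
    IsPositiveMap Φ ↔ PositivityConditions H μ₁ μ₂ μ₃ μ₄ μ₅ μ₆ := by
  refine ⟨fun h => hΦ.positivityConditions h hdim, fun h => ?_⟩
  obtain ⟨h34, rfl⟩ := hasHermitianForm_iff.1 hΦ
  exact isPositiveMap_of_rankOne fun e he => isPositive_sixTerm_rankOne h34 h hdim he

end UnitaryCovariance

end

theorem theorem2 {H : Type*} [NormedAddCommGroup H] [InnerProductSpace ℂ H] [CompleteSpace H]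
    [TopologicalSpace.SeparableSpace H] (hdim : 2 ≤ Module.rank ℂ H)
    (Φ : UnitaryCovariance.TraceClass H →L[ℂ]
      (UnitaryCovariance.HilbertTensor H →L[ℂ] UnitaryCovariance.HilbertTensor H))
    (hΦ : UnitaryCovariance.IsCovariant Φ) :
    (UnitaryCovariance.IsHermitianPreserving Φ ↔
      ∃ (μ₁ μ₂ : ℝ) (μ₃ μ₄ : ℂ) (μ₅ μ₆ : ℝ),
        UnitaryCovariance.HasHermitianForm Φ μ₁ μ₂ μ₃ μ₄ μ₅ μ₆) ∧
    (UnitaryCovariance.IsPositiveMap Φ ↔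
      ∃ (μ₁ μ₂ : ℝ) (μ₃ μ₄ : ℂ) (μ₅ μ₆ : ℝ),
        UnitaryCovariance.HasHermitianForm Φ μ₁ μ₂ μ₃ μ₄ μ₅ μ₆ ∧
          UnitaryCovariance.PositivityConditions H μ₁ μ₂ μ₃ μ₄ μ₅ μ₆) ∧
    (∀ (μ₁ μ₂ : ℝ) (μ₃ μ₄ : ℂ) (μ₅ μ₆ : ℝ),
      UnitaryCovariance.HasHermitianForm Φ μ₁ μ₂ μ₃ μ₄ μ₅ μ₆ →
        (UnitaryCovariance.IsPositiveMap Φ ↔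
          UnitaryCovariance.PositivityConditions H μ₁ μ₂ μ₃ μ₄ μ₅ μ₆)) := by
  refine ⟨⟨fun h => h.exists_hasHermitianForm hΦ hdim, ?_⟩, ⟨fun h => ?_, ?_⟩,
    fun μ₁ μ₂ μ₃ μ₄ μ₅ μ₆ h => h.isPositiveMap_iff hdim⟩
  · rintro ⟨μ₁, μ₂, μ₃, μ₄, μ₅, μ₆, h⟩
    exact h.isHermitianPreserving
  · obtain ⟨μ₁, μ₂, μ₃, μ₄, μ₅, μ₆, hf⟩ := h.exists_hasHermitianForm hΦ hdim
    exact ⟨μ₁, μ₂, μ₃, μ₄, μ₅, μ₆, hf, hf.positivityConditions h hdim⟩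
  · rintro ⟨μ₁, μ₂, μ₃, μ₄, μ₅, μ₆, hf, hc⟩
    exact (hf.isPositiveMap_iff hdim).2 hc
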